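/- Let $E>0$. For $h>0$ consider, for equal charges ($Z_-=0$), the angular operator $$K_\eta(h)=-h^2\partial_\eta^2+E\cos^2\eta$$ on $[-\pi,\pi]$ with periodic boundary conditions $\psi(-\pi)=\psi(\pi)$, $\psi'(-\pi)=\psi'(\pi)$. Its eigenvalues with an even eigenfunction and its eigenvalues with an odd eigenfunction form two strictly increasing infinite sequences $$\mu_0^+(h,E,0)<\mu_1^+(h,E,0)<\cdots,\qquad \mu_0^-(h,E,0)<\mu_1^-(h,E,0)<\cdots,$$ respectively, both indexed from $n=0$. For every $n\in\{0,1,2,\dots\}$, as $h\searrow 0$, $$\mu_n^+(h,E,0)=(2n+1)\sqrt{E}\,h+O(h^2),\qquad \mu_n^-(h,E,0)=(2n+1)\sqrt{E}\,h+O(h^2),$$ where the constants in $O(h^2)$ may depend on $n$ and $E$. -/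

import Mathlib

open Filter Topology Asymptotics

namespace TwoCenters

/-- The angular operator `K_η = -h² ∂_η² + Z₋ cos η + E cos² η`. -/
noncomputable def angularOp (h E Zm : ℝ) (ψ : ℝ → ℝ) (η : ℝ) : ℝ :=
  -h ^ 2 * deriv (deriv ψ) η + (Zm * Real.cos η + E * Real.cos η ^ 2) * ψ η

/-- `ψ` is a (real) eigenfunction of the angular operator with eigenvalue `μ` for periodic boundary
conditions on `[-π, π]`: a nonzero `2π`-periodic `C²` solution of `K_η ψ = μ ψ`.
Since the coefficients are `2π`-periodic, solutions on `[-π, π]` with `ψ(-π) = ψ(π)` and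
`ψ'(-π) = ψ'(π)` are the same thing as `2π`-periodic solutions on the line. -/
structure IsAngularEigenfunction (h E Zm μ : ℝ) (ψ : ℝ → ℝ) : Prop where
  contDiff : ContDiff ℝ 2 ψ
  periodic : Function.Periodic ψ (2 * Real.pi)
  ne_zero : ψ ≠ 0
  eigen : ∀ η, angularOp h E Zm ψ η = μ * ψ η

/-- The eigenvalues of the angular operator on the even functions. -/
def evenSpectrum (h E Zm : ℝ) : Set ℝ :=
  {μ | ∃ ψ, IsAngularEigenfunction h E Zm μ ψ ∧ Function.Even ψ}

/-- The eigenvalues of the angular operator on the odd functions. -/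
def oddSpectrum (h E Zm : ℝ) : Set ℝ :=
  {μ | ∃ ψ, IsAngularEigenfunction h E Zm μ ψ ∧ Function.Odd ψ}

/-- The elements of a set of reals listed in increasing order, starting with index `0`
(meaningful for sets that can be listed as `s₀ < s₁ < s₂ < ⋯`). -/
noncomputable def nthSmallest (S : Set ℝ) : ℕ → ℝ
  | 0 => sInf S
  | n + 1 => sInf (S ∩ Set.Ioi (nthSmallest S n))

/-- `μ_n⁺(h, E, Z₋)`, `n = 0, 1, 2, …`: the eigenvalues with even eigenfunctions, in increasing
order. Each of them is simple on the even functions, so that there are no repetitions. -/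
noncomputable def muPlus (n : ℕ) (h E Zm : ℝ) : ℝ := nthSmallest (evenSpectrum h E Zm) n

/-- `μ_n⁻(h, E, Z₋)`, `n = 0, 1, 2, …`: the eigenvalues with odd eigenfunctions, in increasing
order. Each of them is simple on the odd functions, so that there are no repetitions. For `Z₋ = 0`
this is the one that belongs to the Mathieu sine `se_{n+1}`. -/
noncomputable def muMinus (n : ℕ) (h E Zm : ℝ) : ℝ := nthSmallest (oddSpectrum h E Zm) n

end TwoCenters

/-! The potential E cos² is symmetric about 0 and about π, so even (odd) periodic eigenfunctions are
the Neumann (Dirichlet) eigenfunctions on [0, π], where there is a single well, at π/2. Its harmonic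
approximation predicts the levels (2n+1)√E h.

The Prüfer angle at π is continuous and strictly increasing in μ. The n-th eigenvalue is the μ at
which it equals π/2 + nπ (Neumann, starting from π/2) or π + nπ (Dirichlet, starting from 0):
`muPlus_spec`, `muMinus_spec`. Bounds on eigenvalues thus become bounds on angles, and these follow
from comparing potentials. By `muPlus_le_muMinus` it is enough to bound the Dirichlet levels from
above and the Neumann levels from below.

Both comparison potentials are exactly solvable. On (0, π), E cos² ≤ E cot², with eigenfunctions
sin^s x times a Gegenbauer polynomial in cos x, where s(s-1) = E/h² (`le_angularAngle_pi`). In the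
coordinate centred at the well, E sin² ≥ E tanh² on [-1, 1], with solutions cosh^(-s) x times a
polynomial in sinh x, where s(s+1) = E/h²; between [-1, 1] and ±π/2, Gaussians that satisfy the
Neumann condition take over (`angularAngle_pi_le`). The two energies are h²(s + n(2s ± n)) with s =
√E/h + O(1), which gives the error O(h²). -/

namespace SturmLiouville

open Set Real

/-! ### Prüfer angles: existence and comparison. -/

/-- The Prüfer angle `θ` of a solution of `y'' = -Q y`: `y = r sin θ`, `y' = r cos θ`. -/
def IsPruferAngle (Q θ : ℝ → ℝ) : Prop :=
  ∀ x, HasDerivAt θ (cos (θ x) ^ 2 + Q x * sin (θ x) ^ 2) x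

/-- The pair `(y, y')` is a solution of `y'' = -Q y`. -/
def IsSolution (Q y y' : ℝ → ℝ) : Prop :=
  ∀ x, HasDerivAt y (y' x) x ∧ HasDerivAt y' (-Q x * y x) x

lemma IsPruferAngle.continuous {Q θ : ℝ → ℝ} (hθ : IsPruferAngle Q θ) : Continuous θ :=
  continuous_iff_continuousAt.2 fun x => (hθ x).continuousAt

lemma sin_sq_sub_sin_sq (a b : ℝ) : sin a ^ 2 - sin b ^ 2 = sin (a - b) * sin (a + b) := by
  rw [sin_sub, sin_add]
  nlinarith [sin_sq_add_cos_sq a, sin_sq_add_cos_sq b]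

lemma pruferField_sub (q a b : ℝ) :
    (cos a ^ 2 + q * sin a ^ 2) - (cos b ^ 2 + q * sin b ^ 2)
      = (q - 1) * (sin (a - b) * sin (a + b)) := by
  rw [← sin_sq_sub_sin_sq, cos_sq', cos_sq']
  ring

lemma lipschitzWith_pruferField {q M : ℝ} (hq : |q| ≤ M) :
    LipschitzWith (Real.toNNReal (M + 1)) (fun a : ℝ => cos a ^ 2 + q * sin a ^ 2) := by
  have hM : 0 ≤ M := (abs_nonneg q).trans hq
  refine LipschitzWith.of_dist_le_mul fun a b => ?_
  rw [Real.dist_eq, Real.dist_eq, pruferField_sub, Real.coe_toNNReal _ (by linarith), abs_mul,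
    abs_mul]
  have h1 : |q - 1| ≤ M + 1 := (abs_sub _ _).trans (by simpa using hq)
  have h2 : |sin (a - b)| * |sin (a + b)| ≤ |a - b| * 1 :=
    mul_le_mul abs_sin_le_abs (abs_sin_le_one _) (abs_nonneg _) (abs_nonneg _)
  rw [mul_one] at h2
  exact mul_le_mul h1 h2 (by positivity) (by linarith)

lemma abs_pruferField_le {q M : ℝ} (hq : |q| ≤ M) (a : ℝ) :
    |cos a ^ 2 + q * sin a ^ 2| ≤ M + 1 := by
  have h1 := sin_sq_add_cos_sq a
  have h2 := abs_le.1 hq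
  rw [abs_le]
  constructor <;> nlinarith [sq_nonneg (sin a), sq_nonneg (cos a)]

lemma exists_pruferAngle_Icc {Q : ℝ → ℝ} (hQ : Continuous Q) {M : ℝ} (hM : ∀ x, |Q x| ≤ M)
    (x₀ α T : ℝ) (hT : 0 ≤ T) :
    ∃ θ : ℝ → ℝ, θ x₀ = α ∧ ∀ x ∈ Icc (x₀ - T) (x₀ + T),
      HasDerivWithinAt θ (cos (θ x) ^ 2 + Q x * sin (θ x) ^ 2) (Icc (x₀ - T) (x₀ + T)) x := by
  have hM0 : 0 ≤ M := (abs_nonneg _).trans (hM 0)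
  have key : IsPicardLindelof (fun x a : ℝ => cos a ^ 2 + Q x * sin a ^ 2)
      (tmin := x₀ - T) (tmax := x₀ + T) ⟨x₀, by constructor <;> linarith⟩ α
      (Real.toNNReal ((M + 1) * T)) 0 (Real.toNNReal (M + 1)) (Real.toNNReal (M + 1)) :=
    { lipschitzOnWith := fun x _ => (lipschitzWith_pruferField (hM x)).lipschitzOnWith
      continuousOn := fun a _ => by fun_prop
      norm_le := fun x _ a _ => by
        rw [Real.norm_eq_abs, Real.coe_toNNReal _ (by linarith)]
        exact abs_pruferField_le (hM x) a
      mul_max_le := by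
        rw [Real.coe_toNNReal _ (by linarith), Real.coe_toNNReal _ (by positivity)]
        simp }
  exact key.exists_eq_forall_mem_Icc_hasDerivWithinAt₀

/-- The Prüfer field is bounded and uniformly Lipschitz in the angle, so Picard–Lindelöf works on
intervals of any length; uniqueness glues the local angles. -/
lemma exists_pruferAngle {Q : ℝ → ℝ} (hQ : Continuous Q) {M : ℝ} (hM : ∀ x, |Q x| ≤ M)
    (x₀ α : ℝ) : ∃ θ : ℝ → ℝ, θ x₀ = α ∧ IsPruferAngle Q θ := by
  choose Θ hΘ0 hΘ using fun N : ℕ => exists_pruferAngle_Icc hQ hM x₀ α (N + 1) (by positivity)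
  have hΘ' : ∀ N : ℕ, ∀ x ∈ Ioo (x₀ - (N + 1)) (x₀ + (N + 1)),
      HasDerivAt (Θ N) (cos (Θ N x) ^ 2 + Q x * sin (Θ N x) ^ 2) x := fun N x hx =>
    (hΘ N x (Ioo_subset_Icc_self hx)).hasDerivAt (Icc_mem_nhds hx.1 hx.2)
  have agree : ∀ N K : ℕ, N ≤ K → EqOn (Θ N) (Θ K) (Ioo (x₀ - (N + 1)) (x₀ + (N + 1))) := by
    intro N K hNK
    have hNK' : (N : ℝ) ≤ K := by exact_mod_cast hNK
    have hN : (0 : ℝ) ≤ N := by positivity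
    refine ODE_solution_unique_of_mem_Ioo
      (v := fun x a : ℝ => cos a ^ 2 + Q x * sin a ^ 2) (s := fun _ => univ)
      (K := Real.toNNReal (M + 1)) (t₀ := x₀)
      (fun x _ => (lipschitzWith_pruferField (hM x)).lipschitzOnWith) ⟨by linarith, by linarith⟩
      (fun x hx => ⟨hΘ' N x hx, trivial⟩)
      (fun x hx => ⟨hΘ' K x ⟨by linarith [hx.1], by linarith [hx.2]⟩, trivial⟩)
      (by rw [hΘ0, hΘ0])
  have hmem : ∀ x : ℝ, ∀ y : ℝ, |y - x| < 1 →
      y ∈ Ioo (x₀ - ((⌈|x - x₀|⌉₊ : ℕ) + 1)) (x₀ + ((⌈|x - x₀|⌉₊ : ℕ) + 1)) := by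
    intro x y hy
    have h1 := Nat.le_ceil |x - x₀|
    have h2 := abs_le.1 h1
    have h3 := abs_lt.1 hy
    constructor <;> linarith [h2.1, h2.2, h3.1, h3.2]
  -- The radius N + 1, rather than N, leaves a neighbourhood of x inside the interval chosen for x.
  refine ⟨fun x => Θ ⌈|x - x₀|⌉₊ x, by simp [hΘ0], fun x => ?_⟩
  have h1 := hΘ' ⌈|x - x₀|⌉₊ x (hmem x x (by simp))
  refine h1.congr_of_eventuallyEq ?_
  have : ∀ᶠ y in 𝓝 x, |y - x| < 1 := by
    have := Metric.ball_mem_nhds x one_pos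
    filter_upwards [this] with y hy
    simpa [Real.dist_eq] using hy
  filter_upwards [this] with y hy
  rcases le_total ⌈|y - x₀|⌉₊ ⌈|x - x₀|⌉₊ with h | h
  · exact agree _ _ h (hmem y y (by simp))
  · exact (agree _ _ h (hmem x y hy)).symm

/-- Grönwall's argument with an integrating factor. -/
lemma monotoneOn_mul_exp_neg_integral {A B D : ℝ → ℝ} {a b : ℝ} (hA : Continuous A)
    (hD : ∀ x ∈ Icc a b, HasDerivAt D (A x * D x + B x) x) (hB : ∀ x ∈ Icc a b, 0 ≤ B x) :
    MonotoneOn (fun x => D x * exp (-∫ t in a..x, A t)) (Icc a b) := by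
  have hd : ∀ x ∈ Icc a b, HasDerivAt (fun x => D x * exp (-∫ t in a..x, A t))
      (B x * exp (-∫ t in a..x, A t)) x := by
    intro x hx
    have hI : HasDerivAt (fun x => ∫ t in a..x, A t) (A x) x :=
      intervalIntegral.integral_hasDerivAt_right (hA.intervalIntegrable _ _)
        (hA.stronglyMeasurableAtFilter _ _) hA.continuousAt
    refine ((hD x hx).mul hI.neg.exp).congr_deriv ?_
    simp only [Pi.neg_apply]
    ring
  refine monotoneOn_of_deriv_nonneg (convex_Icc a b)
    (fun x hx => (hd x hx).continuousAt.continuousWithinAt)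
    (fun x hx => (hd x (interior_subset hx)).differentiableAt.differentiableWithinAt)
    fun x hx => ?_
  rw [(hd x (interior_subset hx)).deriv]
  exact mul_nonneg (hB x (interior_subset hx)) (exp_pos _).le

section Comparison

variable {Q₁ Q₂ θ₁ θ₂ : ℝ → ℝ} {a b : ℝ}

/-- The difference D of the angles satisfies D' = A D + B with B = (Q₂ - Q₁) sin² θ₂ ≥ 0, and w is
the integrating factor. Writing sin D = sinc D · D keeps A continuous where the angles meet. -/
lemma IsPruferAngle.monotoneOn_sub (hQ₁ : Continuous Q₁) (h₁ : IsPruferAngle Q₁ θ₁)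
    (h₂ : IsPruferAngle Q₂ θ₂) (hQ : ∀ x ∈ Icc a b, Q₁ x ≤ Q₂ x) :
    ∃ w : ℝ → ℝ, (∀ x, 0 < w x) ∧ MonotoneOn (fun x => (θ₂ x - θ₁ x) * w x) (Icc a b) := by
  have c₁ := h₁.continuous
  have c₂ := h₂.continuous
  refine ⟨fun x => exp (-∫ t in a..x, (Q₁ t - 1) * (sinc (θ₂ t - θ₁ t) * sin (θ₂ t + θ₁ t))),
    fun x => exp_pos _, ?_⟩
  refine monotoneOn_mul_exp_neg_integral (B := fun x => (Q₂ x - Q₁ x) * sin (θ₂ x) ^ 2) ?_ ?_ ?_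
  · have := continuous_sinc
    fun_prop
  · intro x _
    refine ((h₂ x).sub (h₁ x)).congr_deriv ?_
    have hs : sin (θ₂ x - θ₁ x) = sinc (θ₂ x - θ₁ x) * (θ₂ x - θ₁ x) := by
      by_cases h : θ₂ x - θ₁ x = 0
      · simp [h]
      · rw [sinc_of_ne_zero h, div_mul_cancel₀ _ h]
    have := pruferField_sub (Q₁ x) (θ₂ x) (θ₁ x)
    rw [hs] at this
    linear_combination this
  · exact fun x hx => mul_nonneg (sub_nonneg.2 (hQ x hx)) (sq_nonneg _)

lemma IsPruferAngle.le_of_le (hQ₁ : Continuous Q₁) (h₁ : IsPruferAngle Q₁ θ₁)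
    (h₂ : IsPruferAngle Q₂ θ₂) (hQ : ∀ x ∈ Icc a b, Q₁ x ≤ Q₂ x) (hab : a ≤ b)
    (ha : θ₁ a ≤ θ₂ a) : θ₁ b ≤ θ₂ b := by
  obtain ⟨w, hw, hm⟩ := h₁.monotoneOn_sub hQ₁ h₂ hQ
  have h := hm (left_mem_Icc.2 hab) (right_mem_Icc.2 hab) hab
  have h0 : 0 ≤ (θ₂ b - θ₁ b) * w b :=
    (mul_nonneg (sub_nonneg.2 ha) (hw a).le).trans h
  exact sub_nonneg.1 (nonneg_of_mul_nonneg_left h0 (hw b))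

lemma IsPruferAngle.lt_of_lt (hQ₁ : Continuous Q₁) (h₁ : IsPruferAngle Q₁ θ₁)
    (h₂ : IsPruferAngle Q₂ θ₂) (hQ : ∀ x ∈ Icc a b, Q₁ x ≤ Q₂ x) (hab : a ≤ b)
    (ha : θ₁ a < θ₂ a) : θ₁ b < θ₂ b := by
  obtain ⟨w, hw, hm⟩ := h₁.monotoneOn_sub hQ₁ h₂ hQ
  have h := hm (left_mem_Icc.2 hab) (right_mem_Icc.2 hab) hab
  have h0 : 0 < (θ₂ b - θ₁ b) * w b :=
    (mul_pos (sub_pos.2 ha) (hw a)).trans_le h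
  exact sub_pos.1 (pos_of_mul_pos_left h0 (hw b).le)

/-- Equality at b would force the angles to agree on all of [a, b]. Then (Q₂ - Q₁) sin² θ₁ = 0, so
sin θ₁ vanishes on the open interval; but wherever it vanishes θ₁ has derivative 1. -/
lemma IsPruferAngle.lt_of_le_of_lt (hQ₁ : Continuous Q₁) (h₁ : IsPruferAngle Q₁ θ₁)
    (h₂ : IsPruferAngle Q₂ θ₂) (hQ : ∀ x ∈ Icc a b, Q₁ x < Q₂ x) (hab : a < b)
    (ha : θ₁ a ≤ θ₂ a) : θ₁ b < θ₂ b := by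
  have hQ' : ∀ x ∈ Icc a b, Q₁ x ≤ Q₂ x := fun x hx => (hQ x hx).le
  refine lt_of_le_of_ne (h₁.le_of_le hQ₁ h₂ hQ' hab.le ha) fun hb => ?_
  have heq : ∀ x ∈ Icc a b, θ₁ x = θ₂ x := by
    intro x hx
    refine le_antisymm (h₁.le_of_le hQ₁ h₂ (fun y hy => hQ' y ⟨hy.1, hy.2.trans hx.2⟩) hx.1 ha) ?_
    by_contra hlt
    exact (h₁.lt_of_lt hQ₁ h₂ (fun y hy => hQ' y ⟨hx.1.trans hy.1, hy.2⟩) hx.2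
      (lt_of_le_of_ne (h₁.le_of_le hQ₁ h₂ (fun y hy => hQ' y ⟨hy.1, hy.2.trans hx.2⟩) hx.1 ha)
        (fun h => hlt h.ge))).ne hb
  have hder : ∀ x ∈ Ioo a b, sin (θ₁ x) = 0 := by
    intro x hx
    have hev : θ₂ =ᶠ[𝓝 x] θ₁ := by
      filter_upwards [Ioo_mem_nhds hx.1 hx.2] with y hy
      exact (heq y (Ioo_subset_Icc_self hy)).symm
    have e := (h₁ x).unique ((h₂ x).congr_of_eventuallyEq hev.symm)
    rw [← heq x (Ioo_subset_Icc_self hx)] at e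
    have : (Q₂ x - Q₁ x) * sin (θ₁ x) ^ 2 = 0 := by linear_combination -e
    have hq : Q₂ x - Q₁ x ≠ 0 := (sub_pos.2 (hQ x (Ioo_subset_Icc_self hx))).ne'
    simpa [hq] using this
  obtain ⟨x, hx⟩ := exists_between hab
  have hev : (fun y => sin (θ₁ y)) =ᶠ[𝓝 x] fun _ => 0 := by
    filter_upwards [Ioo_mem_nhds hx.1 hx.2] with y hy
    exact hder y hy
  have e := (h₁ x).sin.unique ((hasDerivAt_const x (0 : ℝ)).congr_of_eventuallyEq hev)
  have s0 := hder x hx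
  have c1 := sin_sq_add_cos_sq (θ₁ x)
  rw [s0] at e c1
  have c2 : cos (θ₁ x) ^ 2 = 1 := by linarith
  rw [c2] at e
  have : cos (θ₁ x) = 0 := by linarith
  rw [this] at c2
  norm_num at c2

end Comparison

lemma IsPruferAngle.add_int_mul_pi {Q θ : ℝ → ℝ} (h : IsPruferAngle Q θ) (k : ℤ) :
    IsPruferAngle Q (fun x => θ x + k * π) := by
  intro x
  refine ((h x).add_const _).congr_deriv ?_
  have hk : |cos (k * π)| = 1 := abs_cos_int_mul_pi k
  have hk2 : cos (k * π) ^ 2 = 1 := by rw [← sq_abs, hk, one_pow]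
  rw [cos_add, sin_add, sin_int_mul_pi]
  have e1 : (cos (θ x) * cos (k * π) - sin (θ x) * 0) ^ 2 = cos (θ x) ^ 2 * cos (k * π) ^ 2 := by
    ring
  have e2 : (sin (θ x) * cos (k * π) + cos (θ x) * 0) ^ 2 = sin (θ x) ^ 2 * cos (k * π) ^ 2 := by
    ring
  rw [e1, e2, hk2]
  ring

lemma eventually_slope_pos {f : ℝ → ℝ} {c f' : ℝ} (h : HasDerivAt f f' c) (hf' : 0 < f') :
    ∀ᶠ x in 𝓝[≠] c, 0 < (f x - f c) / (x - c) := by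
  have := (hasDerivAt_iff_tendsto_slope.1 h).eventually (lt_mem_nhds hf')
  filter_upwards [this] with x hx
  rwa [slope_def_field] at hx

/-- A Prüfer angle can cross a multiple of `π` only upwards. -/
lemma IsPruferAngle.int_mul_pi_lt {Q θ : ℝ → ℝ} (h : IsPruferAngle Q θ) {k : ℤ}
    {a b : ℝ} (hab : a < b) (ha : k * π ≤ θ a) : k * π < θ b := by
  have hone : ∀ c, θ c = k * π → HasDerivAt θ 1 c := by
    intro c hc
    have hd := h c
    rw [hc, sin_int_mul_pi] at hd
    have hk2 : cos (k * π) ^ 2 = 1 := by rw [← sq_abs, abs_cos_int_mul_pi, one_pow]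
    rw [hk2] at hd
    simpa using hd
  have strict : ∀ b, a < b → k * π ≤ θ b := by
    intro b hab
    by_contra! hb
    -- At the last point c where θ ≥ kπ, the value is exactly kπ and the slope is 1, so points just
    -- after c also qualify.
    obtain ⟨c, hc⟩ : ∃ c, IsGreatest (Icc a b ∩ {x | k * π ≤ θ x}) c := by
      refine (isCompact_Icc.inter_right ?_).exists_isGreatest ⟨a, left_mem_Icc.2 hab.le, ha⟩
      exact isClosed_le continuous_const h.continuous
    have hcb : c < b := lt_of_le_of_ne hc.1.1.2 (by rintro rfl; exact absurd hc.1.2 hb.not_ge)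
    have hθc : θ c = k * π := by
      refine le_antisymm ?_ hc.1.2
      by_contra! hlt
      obtain ⟨d, hd, hde⟩ := intermediate_value_Icc' hcb.le h.continuous.continuousOn
        ⟨hb.le, hlt.le⟩
      have hdc : d ≤ c := hc.2 ⟨⟨hc.1.1.1.trans hd.1, hd.2⟩, hde.ge⟩
      rw [le_antisymm hdc hd.1] at hde
      linarith
    have hev := (eventually_slope_pos (hone c hθc) one_pos).filter_mono
      (nhdsWithin_mono c (s := Ioi c) (fun x hx => (mem_Ioi.1 hx).ne'))
    obtain ⟨x, hx, hxc⟩ := (hev.and (Ioo_mem_nhdsGT hcb)).exists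
    have hpos : 0 < θ x - θ c := (div_pos_iff_of_pos_right (sub_pos.2 hxc.1)).1 hx
    exact absurd (hc.2 ⟨⟨hc.1.1.1.trans hxc.1.le, hxc.2.le⟩, by
      change k * π ≤ θ x; linarith⟩) hxc.1.not_ge
  refine lt_of_le_of_ne (strict b hab) fun hb => ?_
  have hev := (eventually_slope_pos (hone b hb.symm) one_pos).filter_mono
    (nhdsWithin_mono b (s := Iio b) (fun x hx => (mem_Iio.1 hx).ne))
  obtain ⟨x, hx, hxb⟩ := (hev.and (Ioo_mem_nhdsLT hab)).exists
  have hneg : θ x - θ b < 0 := by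
    by_contra! hge
    exact absurd hx (div_nonpos_of_nonneg_of_nonpos hge (sub_neg.2 hxb.2).le).not_gt
  linarith [strict x hxb.1]

/-! ### From angles to solutions and back. -/

/-- The Prüfer angle is tied to every solution with the same initial direction. -/
lemma IsPruferAngle.solution_mul_eq {Q θ y y' : ℝ → ℝ} (hQ : Continuous Q)
    (h : IsPruferAngle Q θ) {a b : ℝ}
    (hy : ∀ x ∈ Icc a b, HasDerivAt y (y' x) x ∧ HasDerivAt y' (-Q x * y x) x)
    (ha : y' a * sin (θ a) = y a * cos (θ a)) {x : ℝ} (hx : x ∈ Icc a b) :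
    y' x * sin (θ x) = y x * cos (θ x) := by
  have cθ := h.continuous
  have hA : Continuous fun x => (Q x - 1) * (sin (θ x) * cos (θ x)) := by fun_prop
  -- The Wronskian-like quantity y' sin θ - y cos θ solves a homogeneous linear equation, so it
  -- stays 0; monotonicity is applied to it and to its negative.
  have hW : ∀ x ∈ Icc a b, HasDerivAt (fun x => y' x * sin (θ x) - y x * cos (θ x))
      ((Q x - 1) * (sin (θ x) * cos (θ x)) * (y' x * sin (θ x) - y x * cos (θ x)) + 0) x := by
    intro x hx
    refine (((hy x hx).2.mul (h x).sin).sub ((hy x hx).1.mul (h x).cos)).congr_deriv ?_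
    have h1 := sin_sq_add_cos_sq (θ x)
    linear_combination (y' x * cos (θ x) + Q x * y x * sin (θ x)) * h1
  have hW' : ∀ x ∈ Icc a b, HasDerivAt (fun x => -(y' x * sin (θ x) - y x * cos (θ x)))
      ((Q x - 1) * (sin (θ x) * cos (θ x)) * (-(y' x * sin (θ x) - y x * cos (θ x))) + 0) x :=
    fun x hx => (hW x hx).neg.congr_deriv (by ring)
  have hab : a ≤ b := hx.1.trans hx.2
  have m1 := monotoneOn_mul_exp_neg_integral hA hW (fun _ _ => le_rfl)
    (left_mem_Icc.2 hab) hx hx.1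
  have m2 := monotoneOn_mul_exp_neg_integral hA hW' (fun _ _ => le_rfl)
    (left_mem_Icc.2 hab) hx hx.1
  simp only [ha, sub_self, zero_mul, neg_zero] at m1 m2
  have e := exp_pos (-∫ t in a..x, (Q t - 1) * (sin (θ t) * cos (θ t)))
  have p1 := nonneg_of_mul_nonneg_left m1 e
  have p2 := nonneg_of_mul_nonneg_left m2 e
  linarith

/-- The solution of `y'' = -Q y` with a given Prüfer angle. -/
lemma IsPruferAngle.exists_solution {Q θ : ℝ → ℝ} (hQ : Continuous Q) (h : IsPruferAngle Q θ) :
    ∃ r : ℝ → ℝ, (∀ x, 0 < r x) ∧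
      IsSolution Q (fun x => r x * sin (θ x)) (fun x => r x * cos (θ x)) := by
  have cθ := h.continuous
  have hA : Continuous fun x => (1 - Q x) * (sin (θ x) * cos (θ x)) := by fun_prop
  -- The amplitude solves r' = (1 - Q) sin θ cos θ · r.
  refine ⟨fun x => exp (∫ t in (0 : ℝ)..x, (1 - Q t) * (sin (θ t) * cos (θ t))),
    fun x => exp_pos _, fun x => ?_⟩
  have hI : HasDerivAt (fun x => ∫ t in (0 : ℝ)..x, (1 - Q t) * (sin (θ t) * cos (θ t)))
      ((1 - Q x) * (sin (θ x) * cos (θ x))) x :=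
    intervalIntegral.integral_hasDerivAt_right (hA.intervalIntegrable _ _)
      (hA.stronglyMeasurableAtFilter _ _) hA.continuousAt
  have h1 := sin_sq_add_cos_sq (θ x)
  constructor
  · refine (hI.exp.mul (h x).sin).congr_deriv ?_
    linear_combination (exp (∫ t in (0 : ℝ)..x, (1 - Q t) * (sin (θ t) * cos (θ t)))
      * cos (θ x)) * h1
  · refine (hI.exp.mul (h x).cos).congr_deriv ?_
    linear_combination (-exp (∫ t in (0 : ℝ)..x, (1 - Q t) * (sin (θ t) * cos (θ t)))
      * Q x * sin (θ x)) * h1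

lemma IsSolution.eq_zero {Q y y' : ℝ → ℝ} {M : ℝ} (hM : ∀ x, |Q x| ≤ M)
    (h : IsSolution Q y y') {x₀ : ℝ} (h0 : y x₀ = 0) (h0' : y' x₀ = 0) : y = 0 := by
  have hM0 : 0 ≤ M := (abs_nonneg _).trans (hM 0)
  have hlip : ∀ x, LipschitzWith (Real.toNNReal (M + 1))
      (fun p : ℝ × ℝ => ((p.2, -Q x * p.1) : ℝ × ℝ)) := by
    intro x
    refine LipschitzWith.of_dist_le_mul fun p q => ?_
    rw [Real.coe_toNNReal _ (by linarith), Prod.dist_eq, Prod.dist_eq]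
    simp only [Real.dist_eq]
    have h1 : |-Q x * p.1 - -Q x * q.1| = |Q x| * |p.1 - q.1| := by
      rw [← mul_sub, abs_mul, abs_neg]
    rw [h1]
    have a1 := le_max_left |p.1 - q.1| |p.2 - q.2|
    have a2 := le_max_right |p.1 - q.1| |p.2 - q.2|
    refine max_le ?_ ?_
    · nlinarith [abs_nonneg (p.1 - q.1)]
    · have := mul_le_mul (hM x) a1 (abs_nonneg _) hM0
      nlinarith [abs_nonneg (p.1 - q.1)]
  have key := ODE_solution_unique_univ (v := fun x (p : ℝ × ℝ) => ((p.2, -Q x * p.1) : ℝ × ℝ))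
    (s := fun _ => univ) (f := fun x => (y x, y' x)) (g := fun _ => (0, 0)) (t₀ := x₀)
    (fun x => (hlip x).lipschitzOnWith)
    (fun x => ⟨(h x).1.prodMk (h x).2, trivial⟩)
    (fun x => ⟨(hasDerivAt_const x ((0, 0) : ℝ × ℝ)).congr_deriv (by simp; rfl), trivial⟩)
    (by simp [h0, h0'])
  ext x
  exact congrArg Prod.fst (congrFun key x)

lemma IsSolution.sub {Q y y' z z' : ℝ → ℝ} (hy : IsSolution Q y y') (hz : IsSolution Q z z') :
    IsSolution Q (fun x => y x - z x) (fun x => y' x - z' x) := fun x =>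
  ⟨(hy x).1.sub (hz x).1, ((hy x).2.sub (hz x).2).congr_deriv (by ring)⟩

lemma IsSolution.comp_const_sub {Q y y' : ℝ → ℝ} (hy : IsSolution Q y y') (c : ℝ) :
    IsSolution (fun x => Q (c - x)) (fun x => y (c - x)) (fun x => -y' (c - x)) := fun x => by
  have h : HasDerivAt (fun x : ℝ => c - x) (-1) x := by
    simpa using (hasDerivAt_id x).const_sub c
  exact ⟨((hy (c - x)).1.comp x h).congr_deriv (by ring),
    (((hy (c - x)).2.comp x h).neg).congr_deriv (by ring)⟩

/-! ### Sturm's comparison theorem. -/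

lemma deriv_nonneg_of_le_right {f : ℝ → ℝ} {a b f' : ℝ} (hab : a < b) (hf : HasDerivAt f f' a)
    (h : ∀ x ∈ Ioo a b, f a ≤ f x) : 0 ≤ f' := by
  by_contra! hneg
  have hev := (eventually_slope_pos hf.neg (neg_pos.2 hneg)).filter_mono
    (nhdsWithin_mono a (s := Ioi a) (fun x hx => (mem_Ioi.1 hx).ne'))
  obtain ⟨x, hx, hxa⟩ := (hev.and (Ioo_mem_nhdsGT hab)).exists
  have hpos := (div_pos_iff_of_pos_right (sub_pos.2 hxa.1)).1 hx
  simp only [Pi.neg_apply] at hpos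
  linarith [h x hxa]

lemma deriv_nonpos_of_le_left {f : ℝ → ℝ} {a b f' : ℝ} (hab : a < b) (hf : HasDerivAt f f' b)
    (h : ∀ x ∈ Ioo a b, f b ≤ f x) : f' ≤ 0 := by
  have hf2 : HasDerivAt (fun x => f (-x)) (f' * -1) (-b) :=
    HasDerivAt.comp (-b) (by simpa using hf) (hasDerivAt_neg (-b))
  have := deriv_nonneg_of_le_right (neg_lt_neg hab) hf2 fun x hx => by
    simpa using h (-x) ⟨by linarith [hx.2], by linarith [hx.1]⟩
  linarith

lemma pos_or_neg_of_ne_zero {f : ℝ → ℝ} {a b : ℝ} (hf : ContinuousOn f (Ioo a b))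
    (h : ∀ x ∈ Ioo a b, f x ≠ 0) : (∀ x ∈ Ioo a b, 0 < f x) ∨ ∀ x ∈ Ioo a b, f x < 0 := by
  by_contra! hcon
  obtain ⟨⟨x, hx, hfx⟩, y, hy, hfy⟩ := hcon
  obtain ⟨z, hz, hz0⟩ := isPreconnected_Ioo.intermediate_value hx hy hf ⟨hfx, hfy⟩
  exact h z hz hz0

/-- The Wronskian y' u - y u' is strictly decreasing, yet its endpoint values have signs ≤ 0 at a
and ≥ 0 at b. The equation for u is needed only on the open interval, which admits a q that is
singular at the endpoints. -/
lemma sturm_comparison_of_pos {Q q y y' u u' : ℝ → ℝ} {a b : ℝ} (hab : a < b)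
    (hy : IsSolution Q y y') (hu : ∀ x ∈ Icc a b, HasDerivAt u (u' x) x)
    (hu'c : ContinuousOn u' (Icc a b)) (hu' : ∀ x ∈ Ioo a b, HasDerivAt u' (-q x * u x) x)
    (hq : ∀ x ∈ Ioo a b, q x < Q x) (ha : u a = 0) (hb : u b = 0)
    (hu0 : ∀ x ∈ Ioo a b, 0 < u x) (hy0 : ∀ x ∈ Ioo a b, 0 < y x) : False := by
  have hyc : Continuous y := continuous_iff_continuousAt.2 fun x => (hy x).1.continuousAt
  have hy'c : Continuous y' := continuous_iff_continuousAt.2 fun x => (hy x).2.continuousAt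
  have huc : ContinuousOn u (Icc a b) := fun x hx => (hu x hx).continuousAt.continuousWithinAt
  have hW : StrictAntiOn (fun x => y' x * u x - y x * u' x) (Icc a b) := by
    refine strictAntiOn_of_deriv_neg (convex_Icc a b)
      ((hy'c.continuousOn.mul huc).sub (hyc.continuousOn.mul hu'c)) fun x hx => ?_
    rw [interior_Icc] at hx
    have hd := ((hy x).2.mul (hu x (Ioo_subset_Icc_self hx))).sub ((hy x).1.mul (hu' x hx))
    have hval : deriv (fun x => y' x * u x - y x * u' x) x = -((Q x - q x) * (u x * y x)) :=
      (hd.congr_deriv (by ring)).deriv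
    rw [hval, neg_neg_iff_pos]
    exact mul_pos (sub_pos.2 (hq x hx)) (mul_pos (hu0 x hx) (hy0 x hx))
  have hlt := hW (left_mem_Icc.2 hab.le) (right_mem_Icc.2 hab.le) hab
  simp only [ha, hb, mul_zero, zero_sub] at hlt
  have hycl : ∀ x ∈ Icc a b, 0 ≤ y x := by
    intro x hx
    rw [← closure_Ioo hab.ne] at hx
    exact closure_minimal (fun z hz => (hy0 z hz).le) (isClosed_le continuous_const hyc) hx
  have h1 := deriv_nonneg_of_le_right hab (hu a (left_mem_Icc.2 hab.le))
    fun x hx => ha.trans_le (hu0 x hx).le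
  have h2 := deriv_nonpos_of_le_left hab (hu b (right_mem_Icc.2 hab.le))
    fun x hx => hb.trans_le (hu0 x hx).le
  nlinarith [mul_nonneg (hycl a (left_mem_Icc.2 hab.le)) h1,
    mul_nonneg (hycl b (right_mem_Icc.2 hab.le)) (neg_nonneg.2 h2)]

/-- **Sturm's comparison theorem**: a solution of the more oscillating equation vanishes between
two zeros of a solution of the less oscillating one. -/
lemma sturm_comparison {Q q y y' u u' : ℝ → ℝ} {a b : ℝ}
    (hy : IsSolution Q y y') (hu : ∀ x ∈ Icc a b, HasDerivAt u (u' x) x)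
    (hu'c : ContinuousOn u' (Icc a b)) (hu' : ∀ x ∈ Ioo a b, HasDerivAt u' (-q x * u x) x)
    (hq : ∀ x ∈ Ioo a b, q x < Q x) (ha : u a = 0) (hb : u b = 0)
    {c : ℝ} (hc : c ∈ Ioo a b) (huc0 : u c ≠ 0) : ∃ x ∈ Ioo a b, y x = 0 := by
  have hyc : Continuous y := continuous_iff_continuousAt.2 fun x => (hy x).1.continuousAt
  have huc : ContinuousOn u (Icc a b) := fun x hx => (hu x hx).continuousAt.continuousWithinAt
  -- The zeros of u nearest to c on either side bound an interval on which u has constant sign.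
  obtain ⟨α, hα⟩ : ∃ α, IsGreatest (Icc a c ∩ u ⁻¹' {0}) α :=
    (isCompact_Icc.of_isClosed_subset ((huc.mono
      (Icc_subset_Icc_right hc.2.le)).preimage_isClosed_of_isClosed isClosed_Icc
      isClosed_singleton) inter_subset_left).exists_isGreatest ⟨a, left_mem_Icc.2 hc.1.le, ha⟩
  obtain ⟨β, hβ⟩ : ∃ β, IsLeast (Icc c b ∩ u ⁻¹' {0}) β :=
    (isCompact_Icc.of_isClosed_subset ((huc.mono
      (Icc_subset_Icc_left hc.1.le)).preimage_isClosed_of_isClosed isClosed_Icc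
      isClosed_singleton) inter_subset_left).exists_isLeast ⟨b, right_mem_Icc.2 hc.2.le, hb⟩
  have hα0 : u α = 0 := hα.1.2
  have hβ0 : u β = 0 := hβ.1.2
  have hαc : α < c := lt_of_le_of_ne hα.1.1.2 (by rintro rfl; exact huc0 hα0)
  have hcβ : c < β := lt_of_le_of_ne hβ.1.1.1 (by rintro rfl; exact huc0 hβ0)
  have hαβ : α < β := hαc.trans hcβ
  have hsub : Ioo α β ⊆ Ioo a b := Ioo_subset_Ioo hα.1.1.1 hβ.1.1.2
  have hsubI : Icc α β ⊆ Icc a b := Icc_subset_Icc hα.1.1.1 hβ.1.1.2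
  have hne : ∀ x ∈ Ioo α β, u x ≠ 0 := by
    intro x hx h0
    rcases le_total x c with h | h
    · exact absurd (hα.2 ⟨⟨hα.1.1.1.trans hx.1.le, h⟩, h0⟩) hx.1.not_ge
    · exact absurd (hβ.2 ⟨⟨h, hx.2.le.trans hβ.1.1.2⟩, h0⟩) hx.2.not_ge
  by_contra! hyne
  have hneg : IsSolution Q (fun x => -y x) (fun x => -y' x) := fun x =>
    ⟨(hy x).1.neg, (hy x).2.neg.congr_deriv (by ring)⟩
  have hu2 := fun x hx => hu x (hsubI hx)
  have hu'c2 := hu'c.mono hsubI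
  have hu'2 := fun x hx => hu' x (hsub hx)
  have hq2 := fun x hx => hq x (hsub hx)
  have nu : ∀ x ∈ Icc α β, HasDerivAt (fun x => -u x) (-u' x) x := fun x hx => (hu2 x hx).neg
  have nu' : ∀ x ∈ Ioo α β, HasDerivAt (fun x => -u' x) (-q x * -u x) x := fun x hx =>
    (hu'2 x hx).neg.congr_deriv (by ring)
  rcases pos_or_neg_of_ne_zero (huc.mono (hsub.trans Ioo_subset_Icc_self)) hne with hu0 | hu0 <;>
  rcases pos_or_neg_of_ne_zero hyc.continuousOn (fun x hx => hyne x (hsub hx)) with hy0 | hy0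
  · exact sturm_comparison_of_pos hαβ hy hu2 hu'c2 hu'2 hq2 hα0 hβ0 hu0 hy0
  · exact sturm_comparison_of_pos hαβ hneg hu2 hu'c2 hu'2 hq2 hα0 hβ0 hu0
      fun x hx => neg_pos.2 (hy0 x hx)
  · exact sturm_comparison_of_pos hαβ hy nu hu'c2.neg nu' hq2 (by simp [hα0]) (by simp [hβ0])
      (fun x hx => neg_pos.2 (hu0 x hx)) hy0
  · exact sturm_comparison_of_pos hαβ hneg nu hu'c2.neg nu' hq2 (by simp [hα0]) (by simp [hβ0])
      (fun x hx => neg_pos.2 (hu0 x hx)) fun x hx => neg_pos.2 (hy0 x hx)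

/-- Each gap between consecutive zeros of a solution of a less oscillating equation makes the
Prüfer angle gain at least `π`. -/
lemma IsPruferAngle.mul_pi_le_of_zeros {Q θ q u u' : ℝ → ℝ} (hQ : Continuous Q)
    (hθ : IsPruferAngle Q θ) {n : ℕ} {z : ℕ → ℝ} (h0 : 0 ≤ θ (z 0))
    (hz : ∀ i < n, z i < z (i + 1)) (hz0 : ∀ i ≤ n, u (z i) = 0)
    (hne : ∀ i < n, ∃ c ∈ Ioo (z i) (z (i + 1)), u c ≠ 0)
    (hu : ∀ x ∈ Icc (z 0) (z n), HasDerivAt u (u' x) x)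
    (hu'c : ContinuousOn u' (Icc (z 0) (z n)))
    (hu' : ∀ x ∈ Ioo (z 0) (z n), HasDerivAt u' (-q x * u x) x)
    (hq : ∀ x ∈ Ioo (z 0) (z n), q x < Q x) : n * π ≤ θ (z n) := by
  obtain ⟨r, hr, hsol⟩ := hθ.exists_solution hQ
  have hmono : ∀ i j, i ≤ j → j ≤ n → z i ≤ z j := by
    intro i j hij
    induction j, hij using Nat.le_induction with
    | base => exact fun _ => le_rfl
    | succ j _ ih => exact fun hj => (ih (by omega)).trans (hz j hj).le
  have key : ∀ i ≤ n, i * π ≤ θ (z i) := by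
    intro i
    induction i with
    | zero => intro _; simpa using h0
    | succ i ih =>
      intro hi
      have hi' := ih (by omega)
      have hl := hmono 0 i (by omega) (by omega)
      have hrr := hmono (i + 1) n (by omega) le_rfl
      obtain ⟨c, hc, hc0⟩ := hne i hi
      obtain ⟨x, hx, hx0⟩ := sturm_comparison hsol
        (fun x hx => hu x ⟨hl.trans hx.1, hx.2.trans hrr⟩)
        (hu'c.mono (Icc_subset_Icc hl hrr))
        (fun x hx => hu' x ⟨hl.trans_lt hx.1, hx.2.trans_le hrr⟩)
        (fun x hx => hq x ⟨hl.trans_lt hx.1, hx.2.trans_le hrr⟩)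
        (hz0 i (by omega)) (hz0 (i + 1) hi) hc hc0
      have hs : sin (θ x) = 0 := by
        rcases mul_eq_zero.1 hx0 with h | h
        · exact absurd h (hr x).ne'
        · exact h
      obtain ⟨k, hk⟩ := sin_eq_zero_iff.1 hs
      -- A zero x beyond z i has angle kπ > iπ, hence k ≥ i + 1, and the angle stays above kπ after
      -- x.
      have h1 := hθ.int_mul_pi_lt (k := (i : ℤ)) hx.1 (by simpa using hi')
      rw [← hk] at h1
      have h2 : (i : ℤ) < k := by exact_mod_cast lt_of_mul_lt_mul_right h1 pi_pos.le
      have h3 : ((i : ℝ) + 1) ≤ k := by exact_mod_cast h2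
      have h4 := hθ.int_mul_pi_lt (k := k) hx.2 hk.le
      push_cast
      nlinarith [pi_pos]
  exact key n le_rfl

/-! ### The spectra as level sets of the angle at π. -/

open TwoCenters

lemma nthSmallest_range {g : ℕ → ℝ} (hg : StrictMono g) (n : ℕ) :
    nthSmallest (range g) n = g n := by
  induction n with
  | zero =>
    refine IsLeast.csInf_eq ⟨⟨0, rfl⟩, ?_⟩
    rintro _ ⟨k, rfl⟩
    exact hg.monotone (Nat.zero_le k)
  | succ n ih =>
    rw [nthSmallest, ih]
    refine IsLeast.csInf_eq ⟨⟨⟨n + 1, rfl⟩, hg n.lt_succ_self⟩, ?_⟩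
    rintro _ ⟨⟨k, rfl⟩, hk⟩
    exact hg.monotone (hg.lt_iff_lt.1 hk)

lemma exists_strictMono_eq_add_mul {F : ℝ → ℝ} (hF : StrictMono F) (hc : Continuous F)
    {a c p : ℝ} (hp : 0 < p) (ha : F a ≤ c) (hunb : ∀ k : ℕ, ∃ μ, c + k * p ≤ F μ) :
    ∃ g : ℕ → ℝ, StrictMono g ∧ ∀ k, F (g k) = c + k * p := by
  have hex : ∀ k : ℕ, ∃ μ, F μ = c + k * p := by
    intro k
    obtain ⟨b, hb⟩ := hunb k
    have hk : 0 ≤ (k : ℝ) * p := by positivity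
    have : c + k * p ∈ range F := mem_range_of_exists_le_of_exists_ge hc ⟨a, by linarith⟩ ⟨b, hb⟩
    exact this
  choose g hg using hex
  refine ⟨g, fun i j hij => hF.lt_iff_lt.1 ?_, hg⟩
  rw [hg, hg]
  have : (i : ℝ) < j := by exact_mod_cast hij
  nlinarith

/-- The angular eigenvalue equation with `Z₋ = 0` reads `ψ'' = -Q ψ` with this `Q`. -/
noncomputable def angularQ (h E μ x : ℝ) : ℝ := (μ - E * cos x ^ 2) / h ^ 2

lemma continuous_angularQ (h E μ : ℝ) : Continuous (angularQ h E μ) := by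
  unfold angularQ
  fun_prop

lemma abs_angularQ_le (h E μ x : ℝ) : |angularQ h E μ x| ≤ (|μ| + |E|) / h ^ 2 := by
  unfold angularQ
  rw [abs_div, abs_of_nonneg (sq_nonneg h)]
  refine div_le_div_of_nonneg_right ?_ (sq_nonneg h)
  refine (abs_sub _ _).trans ?_
  rw [abs_mul, abs_of_nonneg (sq_nonneg (cos x))]
  have := mul_le_mul_of_nonneg_left (cos_sq_le_one x) (abs_nonneg E)
  linarith

lemma angularQ_lt {h : ℝ} (hh : 0 < h) (E x : ℝ) {μ ν : ℝ} (hμν : μ < ν) :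
    angularQ h E μ x < angularQ h E ν x :=
  div_lt_div_of_pos_right (by linarith) (by positivity)

lemma exists_angularAngle (h E α μ : ℝ) :
    ∃ θ : ℝ → ℝ, θ 0 = α ∧ IsPruferAngle (angularQ h E μ) θ :=
  exists_pruferAngle (continuous_angularQ h E μ) (abs_angularQ_le h E μ) 0 α

/-- The Prüfer angle with value `α` at `0`. -/
noncomputable def angularAngle (h E α μ : ℝ) : ℝ → ℝ := (exists_angularAngle h E α μ).choose

lemma angularAngle_zero (h E α μ : ℝ) : angularAngle h E α μ 0 = α :=
  (exists_angularAngle h E α μ).choose_spec.1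

lemma isPruferAngle_angularAngle (h E α μ : ℝ) :
    IsPruferAngle (angularQ h E μ) (angularAngle h E α μ) :=
  (exists_angularAngle h E α μ).choose_spec.2

lemma strictMono_angularAngle_pi {h : ℝ} (hh : 0 < h) (E α : ℝ) :
    StrictMono fun μ => angularAngle h E α μ π := fun μ ν hμν =>
  (isPruferAngle_angularAngle h E α μ).lt_of_le_of_lt (continuous_angularQ h E μ)
    (isPruferAngle_angularAngle h E α ν) (fun x _ => angularQ_lt hh E x hμν) pi_pos
    (by rw [angularAngle_zero, angularAngle_zero])

/-- Grönwall: the Prüfer fields for ν and μ differ by at most |ν - μ| / h². -/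
lemma continuous_angularAngle_pi (h E α : ℝ) :
    Continuous fun μ => angularAngle h E α μ π := by
  refine continuous_iff_continuousAt.2 fun μ => ?_
  obtain ⟨K, hK⟩ : ∃ K : NNReal, ∀ x, LipschitzWith K
      (fun a : ℝ => cos a ^ 2 + angularQ h E μ x * sin a ^ 2) :=
    ⟨_, fun x => lipschitzWith_pruferField (abs_angularQ_le h E μ x)⟩
  have hb : ∀ ν, dist (angularAngle h E α ν π) (angularAngle h E α μ π)
      ≤ gronwallBound 0 K (|ν - μ| / h ^ 2 + 0) π := by
    intro ν
    have := dist_le_of_approx_trajectories_ODE (a := 0) (b := π) (δ := 0)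
      (εf := |ν - μ| / h ^ 2) (εg := 0) hK
      (isPruferAngle_angularAngle h E α ν).continuous.continuousOn
      (fun x _ => (isPruferAngle_angularAngle h E α ν x).hasDerivWithinAt) ?_
      (isPruferAngle_angularAngle h E α μ).continuous.continuousOn
      (fun x _ => (isPruferAngle_angularAngle h E α μ x).hasDerivWithinAt)
      (fun x _ => by rw [dist_self])
      (by rw [angularAngle_zero, angularAngle_zero, dist_self]) π ⟨pi_pos.le, le_rfl⟩
    · simpa using this
    · intro x _
      rw [Real.dist_eq]
      have e : cos (angularAngle h E α ν x) ^ 2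
          + angularQ h E ν x * sin (angularAngle h E α ν x) ^ 2
          - (cos (angularAngle h E α ν x) ^ 2
          + angularQ h E μ x * sin (angularAngle h E α ν x) ^ 2)
          = (ν - μ) / h ^ 2 * sin (angularAngle h E α ν x) ^ 2 := by
        unfold angularQ
        ring
      rw [e, abs_mul, abs_div, abs_of_nonneg (sq_nonneg h), abs_of_nonneg (sq_nonneg (sin _))]
      exact mul_le_of_le_one_right (by positivity) (sin_sq_le_one _)
  refine tendsto_iff_dist_tendsto_zero.2 ?_
  have hlim : Tendsto (fun ν => gronwallBound 0 K (|ν - μ| / h ^ 2 + 0) π) (𝓝 μ) (𝓝 0) := by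
    have hc : Continuous fun ν => gronwallBound 0 K (|ν - μ| / h ^ 2 + 0) π :=
      (gronwallBound_continuous_ε 0 K π).comp (by fun_prop)
    have := hc.tendsto μ
    simpa [gronwallBound_ε0] using this
  exact squeeze_zero (fun _ => dist_nonneg) hb hlim

lemma angularAngle_pi_pos {h E α μ : ℝ} (hα : 0 ≤ α) : 0 < angularAngle h E α μ π := by
  have := (isPruferAngle_angularAngle h E α μ).int_mul_pi_lt (k := 0) pi_pos
    (by simpa [angularAngle_zero] using hα)
  simpa using this

lemma angularAngle_pi_lt {h E α β μ : ℝ} (hαβ : α < β) :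
    angularAngle h E α μ π < angularAngle h E β μ π :=
  (isPruferAngle_angularAngle h E α μ).lt_of_lt (continuous_angularQ h E μ)
    (isPruferAngle_angularAngle h E β μ) (fun _ _ => le_rfl) pi_pos.le
    (by rwa [angularAngle_zero, angularAngle_zero])

/-- At μ = 0 one has Q ≤ 0, and the constant angle π/2 belongs to Q = 0. This provides a μ at or
below the lowest level, so that the enumeration starts at k = 0. -/
lemma angularAngle_pi_div_two_zero_le {h E : ℝ} (hE : 0 ≤ E) :
    angularAngle h E (π / 2) 0 π ≤ π / 2 := by
  have hc : IsPruferAngle (fun _ => 0) (fun _ => π / 2) := fun x => by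
    simpa using hasDerivAt_const x (π / 2)
  refine (isPruferAngle_angularAngle h E (π / 2) 0).le_of_le (continuous_angularQ h E 0) hc
    (fun x _ => ?_) pi_pos.le (angularAngle_zero h E _ 0).le
  unfold angularQ
  refine div_nonpos_of_nonpos_of_nonneg ?_ (sq_nonneg h)
  nlinarith [mul_nonneg hE (sq_nonneg (cos x))]

/-- Once μ exceeds E + h² n², Q > n² everywhere, and the zeros iπ/n of sin (n x) force n half-turns.
Hence arbitrarily high levels are attained. -/
lemma exists_le_angularAngle_pi {h E : ℝ} (hh : 0 < h) (hE : 0 ≤ E) (n : ℕ) :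
    ∃ μ, n * π ≤ angularAngle h E 0 μ π := by
  rcases Nat.eq_zero_or_pos n with rfl | hn
  · exact ⟨0, by simpa using (angularAngle_pi_pos le_rfl).le⟩
  have hn' : (0 : ℝ) < n := by exact_mod_cast hn
  refine ⟨E + h ^ 2 * n ^ 2 + 1, ?_⟩
  have hs : ∀ x : ℝ, HasDerivAt (fun x : ℝ => (n : ℝ) * x) n x := fun x => by
    simpa using (hasDerivAt_id x).const_mul (n : ℝ)
  have hzn : (n : ℝ) * π / n = π := by field_simp
  have key := (isPruferAngle_angularAngle h E 0 (E + h ^ 2 * n ^ 2 + 1)).mul_pi_le_of_zeros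
    (continuous_angularQ h E _) (n := n) (z := fun i : ℕ => (i : ℝ) * π / n)
    (u := fun x => sin (n * x)) (u' := fun x => cos (n * x) * n) (q := fun _ => (n : ℝ) ^ 2)
    (by simp [angularAngle_zero]) (fun i _ => ?_) (fun i _ => ?_) (fun i _ => ?_)
    (fun x _ => (hs x).sin) (by fun_prop)
    (fun x _ => ((hs x).cos.mul_const _).congr_deriv (by ring)) (fun x _ => ?_)
  · rwa [hzn] at key
  · refine div_lt_div_of_pos_right ?_ hn'
    push_cast
    nlinarith [pi_pos]
  · have : (n : ℝ) * (i * π / n) = i * π := by field_simp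
    simp [this]
  · refine ⟨((i : ℝ) + 1 / 2) * π / n, ⟨div_lt_div_of_pos_right ?_ hn',
      div_lt_div_of_pos_right ?_ hn'⟩, ?_⟩
    · nlinarith [pi_pos]
    · push_cast
      nlinarith [pi_pos]
    · have : (n : ℝ) * (((i : ℝ) + 1 / 2) * π / n) = i * π + π / 2 := by field_simp
      simp only [this, sin_add_pi_div_two, ne_eq]
      have := abs_cos_int_mul_pi (i : ℤ)
      intro h0
      rw [Int.cast_natCast, h0] at this
      norm_num at this
  · unfold angularQ
    rw [lt_div_iff₀ (by positivity)]
    nlinarith [mul_le_mul_of_nonneg_left (cos_sq_le_one x) hE]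

lemma isSolution_of_isAngularEigenfunction {h E μ : ℝ} (hh : 0 < h) {ψ : ℝ → ℝ}
    (hψ : IsAngularEigenfunction h E 0 μ ψ) : IsSolution (angularQ h E μ) ψ (deriv ψ) := by
  intro x
  have hd : Differentiable ℝ ψ := hψ.contDiff.differentiable (by norm_num)
  have hd' : Differentiable ℝ (deriv ψ) := by
    have : ContDiff ℝ 1 (deriv ψ) := ContDiff.deriv' (n := 1) (by
      rw [show (1 : WithTop ℕ∞) + 1 = 2 by norm_num]; exact hψ.contDiff)
    exact this.differentiable (by norm_num)
  refine ⟨(hd x).hasDerivAt, (hd' x).hasDerivAt.congr_deriv ?_⟩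
  have := hψ.eigen x
  unfold angularOp at this
  unfold angularQ
  field_simp
  linear_combination -this

lemma isAngularEigenfunction_of_isSolution {h E μ : ℝ} (hh : 0 < h) {y y' : ℝ → ℝ}
    (hy : IsSolution (angularQ h E μ) y y') (hp : Function.Periodic y (2 * π)) (h0 : y ≠ 0) :
    IsAngularEigenfunction h E 0 μ y := by
  have hyd : deriv y = y' := funext fun x => (hy x).1.deriv
  have hy'd : deriv y' = fun x => -angularQ h E μ x * y x := funext fun x => (hy x).2.deriv
  have hyc : Continuous y := continuous_iff_continuousAt.2 fun x => (hy x).1.continuousAt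
  refine ⟨?_, hp, h0, fun x => ?_⟩
  · have h1 : ContDiff ℝ 1 y' := by
      rw [contDiff_one_iff_deriv]
      refine ⟨fun x => (hy x).2.differentiableAt, ?_⟩
      rw [hy'd]
      exact (continuous_angularQ h E μ).neg.mul hyc
    rw [show (2 : WithTop ℕ∞) = 1 + 1 by norm_num, contDiff_succ_iff_deriv]
    refine ⟨fun x => (hy x).1.differentiableAt, by simp, ?_⟩
    rwa [hyd]
  · unfold angularOp
    rw [hyd, hy'd]
    unfold angularQ
    field_simp
    ring

lemma angularQ_const_sub {h E μ : ℝ} {c : ℝ} (hc : ∀ x, cos (c - x) ^ 2 = cos x ^ 2) :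
    (fun x => angularQ h E μ (c - x)) = angularQ h E μ := by
  ext x
  rw [angularQ, angularQ, hc]

/-- A solution with `y'(c/2) = 0` is symmetric about `c/2` if the potential is. -/
lemma IsSolution.symm_of_deriv_eq_zero {h E μ : ℝ} {y y' : ℝ → ℝ}
    (hy : IsSolution (angularQ h E μ) y y') {c : ℝ} (hc : ∀ x, cos (c - x) ^ 2 = cos x ^ 2)
    (h0 : y' (c / 2) = 0) (x : ℝ) : y (c - x) = y x := by
  have h1 := hy.comp_const_sub c
  rw [angularQ_const_sub hc] at h1
  have := (h1.sub hy).eq_zero (abs_angularQ_le h E μ) (x₀ := c / 2) (by ring_nf)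
    (by rw [show c - c / 2 = c / 2 by ring, h0]; ring)
  exact sub_eq_zero.1 (congrFun this x)

/-- A solution with `y(c/2) = 0` is antisymmetric about `c/2` if the potential is symmetric. -/
lemma IsSolution.antisymm_of_eq_zero {h E μ : ℝ} {y y' : ℝ → ℝ}
    (hy : IsSolution (angularQ h E μ) y y') {c : ℝ} (hc : ∀ x, cos (c - x) ^ 2 = cos x ^ 2)
    (h0 : y (c / 2) = 0) (x : ℝ) : y (c - x) = -y x := by
  have h1 := hy.comp_const_sub c
  rw [angularQ_const_sub hc] at h1
  have h2 : IsSolution (angularQ h E μ) (fun x => -y (c - x)) (fun x => y' (c - x)) := fun x =>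
    ⟨(h1 x).1.neg.congr_deriv (by ring), (h1 x).2.neg.congr_deriv (by ring) |>.congr_of_eventuallyEq
      (Eventually.of_forall fun x => by simp)⟩
  have := (h2.sub hy).eq_zero (abs_angularQ_le h E μ) (x₀ := c / 2)
    (by rw [show c - c / 2 = c / 2 by ring, h0]; ring)
    (by rw [show c - c / 2 = c / 2 by ring]; ring)
  have := congrFun this x
  simp only [Pi.zero_apply] at this
  linarith

lemma cos_zero_sub_sq (x : ℝ) : cos (0 - x) ^ 2 = cos x ^ 2 := by simp

lemma cos_two_pi_sub_sq (x : ℝ) : cos (2 * π - x) ^ 2 = cos x ^ 2 := by rw [cos_two_pi_sub]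

/-- Evenness and periodicity give symmetry about 0 and π, hence ψ' = 0 at both, which for the angle
means cos θ = 0. Conversely, such a solution is symmetric about both points, and the two reflections
compose to the translation by 2π. Negative k is excluded because the angle at π is positive. -/
lemma mem_evenSpectrum_iff {h E μ : ℝ} (hh : 0 < h) :
    μ ∈ evenSpectrum h E 0 ↔ ∃ k : ℕ, angularAngle h E (π / 2) μ π = π / 2 + k * π := by
  have hθ := isPruferAngle_angularAngle h E (π / 2) μ
  have hQ := continuous_angularQ h E μ
  constructor
  · rintro ⟨ψ, hψ, heven⟩
    have hsol := isSolution_of_isAngularEigenfunction hh hψ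
    have d0 : ∀ c, (∀ x, ψ (c - x) = ψ x) → deriv ψ (c / 2) = 0 := by
      intro c hc
      have h1 := (hsol (c - c / 2)).1.comp (c / 2) ((hasDerivAt_id (c / 2)).const_sub c)
      have h2 := h1.unique ((hsol (c / 2)).1.congr_of_eventuallyEq
        (Eventually.of_forall fun x => by simpa using hc x))
      rw [show c - c / 2 = c / 2 by ring] at h2
      linarith
    have h0 : deriv ψ 0 = 0 := by
      simpa using d0 0 fun x => by rw [zero_sub]; exact heven x
    have hpi : deriv ψ π = 0 := by
      have := d0 (2 * π) fun x => by
        rw [← heven x, ← hψ.periodic (-x)]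
        ring_nf
      rwa [show 2 * π / 2 = π by ring] at this
    have hψpi : ψ π ≠ 0 := fun hz =>
      hψ.ne_zero (hsol.eq_zero (abs_angularQ_le h E μ) hz hpi)
    have e := hθ.solution_mul_eq hQ (fun x _ => hsol x) (a := 0) (b := π)
      (by rw [angularAngle_zero, h0, cos_pi_div_two]; ring) ⟨pi_pos.le, le_rfl⟩
    rw [hpi, zero_mul] at e
    have hcos : cos (angularAngle h E (π / 2) μ π) = 0 := by
      rcases mul_eq_zero.1 e.symm with h | h
      · exact absurd h hψpi
      · exact h
    obtain ⟨k, hk⟩ := cos_eq_zero_iff.1 hcos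
    have hpos : 0 < angularAngle h E (π / 2) μ π := angularAngle_pi_pos (by positivity)
    have hk0 : 0 ≤ k := by
      by_contra! hneg
      have : (k : ℝ) ≤ -1 := by exact_mod_cast Int.le_sub_one_of_lt hneg
      rw [hk] at hpos
      nlinarith [pi_pos]
    lift k to ℕ using hk0
    exact ⟨k, by rw [hk]; push_cast; ring⟩
  · rintro ⟨k, hk⟩
    obtain ⟨r, hr, hsol⟩ := hθ.exists_solution hQ
    have s0 := hsol.symm_of_deriv_eq_zero cos_zero_sub_sq
      (by simp [angularAngle_zero])
    have s1 := hsol.symm_of_deriv_eq_zero cos_two_pi_sub_sq (by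
      rw [show 2 * π / 2 = π by ring, hk, add_comm, cos_add_pi_div_two, sin_nat_mul_pi]; simp)
    refine ⟨_, isAngularEigenfunction_of_isSolution hh hsol (fun x => ?_) ?_, fun x => ?_⟩
    · rw [← s1, ← s0]
      ring_nf
    · intro hz
      have := congrFun hz 0
      simp [angularAngle_zero, (hr 0).ne'] at this
    · rw [← s0 x, zero_sub]

lemma mem_oddSpectrum_iff {h E μ : ℝ} (hh : 0 < h) :
    μ ∈ oddSpectrum h E 0 ↔ ∃ k : ℕ, angularAngle h E 0 μ π = π + k * π := by
  have hθ := isPruferAngle_angularAngle h E 0 μ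
  have hQ := continuous_angularQ h E μ
  constructor
  · rintro ⟨ψ, hψ, hodd⟩
    have hsol := isSolution_of_isAngularEigenfunction hh hψ
    have h0 : ψ 0 = 0 := by
      have := hodd 0
      rw [neg_zero] at this
      linarith
    have hpi : ψ π = 0 := by
      have h1 := hodd π
      have h2 := hψ.periodic (-π)
      rw [show -π + 2 * π = π by ring] at h2
      linarith
    have hψpi : deriv ψ π ≠ 0 := fun hz =>
      hψ.ne_zero (hsol.eq_zero (abs_angularQ_le h E μ) hpi hz)
    have e := hθ.solution_mul_eq hQ (fun x _ => hsol x) (a := 0) (b := π)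
      (by rw [angularAngle_zero, h0, sin_zero]; ring) ⟨pi_pos.le, le_rfl⟩
    rw [hpi, zero_mul] at e
    have hsin : sin (angularAngle h E 0 μ π) = 0 := by
      rcases mul_eq_zero.1 e with h | h
      · exact absurd h hψpi
      · exact h
    obtain ⟨k, hk⟩ := sin_eq_zero_iff.1 hsin
    have hpos : 0 < angularAngle h E 0 μ π := angularAngle_pi_pos le_rfl
    -- Positivity of the angle also excludes the multiple 0 of π, whence the shift by one in the
    -- level.
    have hk0 : 0 ≤ k - 1 := by
      by_contra! hneg
      have : (k : ℝ) ≤ 0 := by exact_mod_cast (by omega : k ≤ 0)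
      rw [← hk] at hpos
      nlinarith [pi_pos]
    obtain ⟨m, hm⟩ := Int.eq_ofNat_of_zero_le hk0
    refine ⟨m, ?_⟩
    have : (k : ℝ) = m + 1 := by exact_mod_cast (by omega : k = m + 1)
    rw [← hk, this]
    ring
  · rintro ⟨k, hk⟩
    obtain ⟨r, hr, hsol⟩ := hθ.exists_solution hQ
    have s0 := hsol.antisymm_of_eq_zero cos_zero_sub_sq
      (by simp [angularAngle_zero])
    have s1 := hsol.antisymm_of_eq_zero cos_two_pi_sub_sq (by
      rw [show 2 * π / 2 = π by ring, hk,
        show π + k * π = ((k + 1 : ℕ) : ℝ) * π by push_cast; ring, sin_nat_mul_pi, mul_zero])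
    refine ⟨_, isAngularEigenfunction_of_isSolution hh hsol (fun x => ?_) ?_, fun x => ?_⟩
    · have e1 := s1 (-x)
      have e0 := s0 x
      rw [show 2 * π - -x = x + 2 * π by ring] at e1
      rw [zero_sub] at e0
      rw [e1, e0, neg_neg]
    · intro hz
      have := (hsol 0).1
      rw [hz] at this
      have := this.unique (hasDerivAt_const 0 (0 : ℝ))
      simp [angularAngle_zero, (hr 0).ne'] at this
    · have e0 := s0 x
      rwa [zero_sub] at e0

lemma muPlus_spec {h E : ℝ} (hh : 0 < h) (hE : 0 ≤ E) :
    (StrictMono fun n => muPlus n h E 0) ∧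
      range (fun n => muPlus n h E 0) = evenSpectrum h E 0 ∧
      ∀ n : ℕ, angularAngle h E (π / 2) (muPlus n h E 0) π = π / 2 + n * π := by
  obtain ⟨g, hg, hgF⟩ := exists_strictMono_eq_add_mul (strictMono_angularAngle_pi hh E (π / 2))
    (continuous_angularAngle_pi h E (π / 2)) pi_pos (angularAngle_pi_div_two_zero_le hE) (by
      intro k
      obtain ⟨μ, hμ⟩ := exists_le_angularAngle_pi hh hE (k + 1)
      refine ⟨μ, ?_⟩
      have := angularAngle_pi_lt (h := h) (E := E) (μ := μ) pi_div_two_pos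
      push_cast at hμ
      linarith [pi_pos])
  have hS : evenSpectrum h E 0 = range g := by
    ext μ
    rw [mem_evenSpectrum_iff hh]
    constructor
    · rintro ⟨k, hk⟩
      exact ⟨k, (strictMono_angularAngle_pi hh E (π / 2)).injective ((hgF k).trans hk.symm)⟩
    · rintro ⟨k, rfl⟩
      exact ⟨k, hgF k⟩
  have hm : (fun n => muPlus n h E 0) = g := by
    ext n
    rw [muPlus, hS, nthSmallest_range hg]
  rw [hm, hS]
  exact ⟨hg, rfl, fun n => by rw [← hgF n, ← congrFun hm n]⟩

lemma muMinus_spec {h E : ℝ} (hh : 0 < h) (hE : 0 ≤ E) :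
    (StrictMono fun n => muMinus n h E 0) ∧
      range (fun n => muMinus n h E 0) = oddSpectrum h E 0 ∧
      ∀ n : ℕ, angularAngle h E 0 (muMinus n h E 0) π = π + n * π := by
  obtain ⟨g, hg, hgF⟩ := exists_strictMono_eq_add_mul (strictMono_angularAngle_pi hh E 0)
    (continuous_angularAngle_pi h E 0) pi_pos (a := 0) (c := π) (by
      have h1 := angularAngle_pi_lt (h := h) (E := E) (μ := 0) pi_div_two_pos
      have h2 := angularAngle_pi_div_two_zero_le (h := h) hE
      linarith [pi_pos]) (by
      intro k
      obtain ⟨μ, hμ⟩ := exists_le_angularAngle_pi hh hE (k + 1)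
      refine ⟨μ, ?_⟩
      push_cast at hμ
      linarith [pi_pos])
  have hS : oddSpectrum h E 0 = range g := by
    ext μ
    rw [mem_oddSpectrum_iff hh]
    constructor
    · rintro ⟨k, hk⟩
      exact ⟨k, (strictMono_angularAngle_pi hh E 0).injective ((hgF k).trans hk.symm)⟩
    · rintro ⟨k, rfl⟩
      exact ⟨k, hgF k⟩
  have hm : (fun n => muMinus n h E 0) = g := by
    ext n
    rw [muMinus, hS, nthSmallest_range hg]
  rw [hm, hS]
  exact ⟨hg, rfl, fun n => by rw [← hgF n, ← congrFun hm n]⟩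

/-- Neumann eigenvalues lie below Dirichlet eigenvalues. -/
lemma muPlus_le_muMinus {h E : ℝ} (hh : 0 < h) (hE : 0 ≤ E) (n : ℕ) :
    muPlus n h E 0 ≤ muMinus n h E 0 := by
  rw [← (strictMono_angularAngle_pi hh E (π / 2)).le_iff_le]
  have h1 := angularAngle_pi_lt (h := h) (E := E) (μ := muMinus n h E 0) pi_div_two_pos
  rw [(muMinus_spec hh hE).2.2] at h1
  simp only [(muPlus_spec hh hE).2.2]
  linarith [pi_pos]

/-! ### Ladder polynomials. -/

open Polynomial

/-- Unnormalized Gegenbauer polynomials (`ε = 1`) and, up to factors of `i`, their values on the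
imaginary axis (`ε = -1`), built by the raising operator. -/
noncomputable def ladderPoly (ε : ℝ) : ℕ → ℝ → ℝ[X]
  | 0, _ => 1
  | n + 1, s => C (ε * (2 * s + 1)) * X * ladderPoly ε n (s + 1)
      - (1 - C ε * X ^ 2) * derivative (ladderPoly ε n (s + 1))

/-- The two claims feed each other: the differential equation for (n, s + 1) gives the lowering
relation for (n + 1, s), and this together with the raising definition gives the differential
equation for (n + 1, s). -/
lemma ladderPoly_ode (ε : ℝ) (n : ℕ) (s : ℝ) :
    (1 - C ε * X ^ 2) * derivative (derivative (ladderPoly ε n s))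
      - C (ε * (2 * s + 1)) * X * derivative (ladderPoly ε n s)
      + C (ε * n * (n + 2 * s)) * ladderPoly ε n s = 0 ∧
    derivative (ladderPoly ε (n + 1) s)
      = C (ε * (n + 1) * (n + 2 * s + 1)) * ladderPoly ε n (s + 1) := by
  have step : ∀ n : ℕ, ∀ s : ℝ,
      (1 - C ε * X ^ 2) * derivative (derivative (ladderPoly ε n (s + 1)))
      - C (ε * (2 * (s + 1) + 1)) * X * derivative (ladderPoly ε n (s + 1))
      + C (ε * n * (n + 2 * (s + 1))) * ladderPoly ε n (s + 1) = 0 →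
      derivative (ladderPoly ε (n + 1) s)
      = C (ε * (n + 1) * (n + 2 * s + 1)) * ladderPoly ε n (s + 1) := by
    intro n s h
    rw [ladderPoly]
    simp only [derivative_sub, derivative_mul, derivative_C, derivative_X, derivative_one,
      derivative_X_pow] at h ⊢
    simp only [map_mul, map_add, map_one, map_ofNat, map_natCast] at h ⊢
    push_cast at h ⊢
    linear_combination -h
  have ode : ∀ n : ℕ, ∀ s : ℝ,
      (1 - C ε * X ^ 2) * derivative (derivative (ladderPoly ε n s))
      - C (ε * (2 * s + 1)) * X * derivative (ladderPoly ε n s)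
      + C (ε * n * (n + 2 * s)) * ladderPoly ε n s = 0 := by
    intro n
    induction n with
    | zero => intro s; simp [ladderPoly]
    | succ n ih =>
      intro s
      rw [step n s (ih (s + 1)), derivative_C_mul]
      rw [ladderPoly]
      push_cast
      simp only [map_mul, map_add, map_one, map_ofNat, map_natCast]
      ring
  exact ⟨ode n s, step n s (ode n (s + 1))⟩

lemma derivative_ladderPoly_succ (ε : ℝ) (n : ℕ) (s : ℝ) :
    derivative (ladderPoly ε (n + 1) s)
      = C (ε * (n + 1) * (n + 2 * s + 1)) * ladderPoly ε n (s + 1) :=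
  (ladderPoly_ode ε n s).2

lemma eval_ladderPoly_ode (ε : ℝ) (n : ℕ) (s y : ℝ) :
    (1 - ε * y ^ 2) * (derivative (derivative (ladderPoly ε n s))).eval y
      - ε * (2 * s + 1) * y * (derivative (ladderPoly ε n s)).eval y
      + ε * n * (n + 2 * s) * (ladderPoly ε n s).eval y = 0 := by
  have := congrArg (eval y) (ladderPoly_ode ε n s).1
  simpa using this

lemma eval_ladderPoly_succ (ε : ℝ) (n : ℕ) (s y : ℝ) :
    (ladderPoly ε (n + 1) s).eval y = ε * (2 * s + 1) * y * (ladderPoly ε n (s + 1)).eval y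
      - (1 - ε * y ^ 2) * (derivative (ladderPoly ε n (s + 1))).eval y := by
  rw [ladderPoly]
  simp

lemma natDegree_ladderPoly_le (ε : ℝ) (n : ℕ) (s : ℝ) : (ladderPoly ε n s).natDegree ≤ n := by
  induction n generalizing s with
  | zero => simp [ladderPoly]
  | succ n ih =>
    rw [natDegree_le_iff_coeff_eq_zero]
    intro k hk
    obtain ⟨k, rfl⟩ := Nat.exists_eq_succ_of_ne_zero (by omega : k ≠ 0)
    have h1 := congrArg (fun p => coeff p k) (derivative_ladderPoly_succ ε n s)
    simp only [coeff_derivative, coeff_C_mul] at h1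
    rw [natDegree_le_iff_coeff_eq_zero.1 (ih (s + 1)) k (by omega), mul_zero] at h1
    have : (k : ℝ) + 1 ≠ 0 := by positivity
    simpa [this] using h1

lemma ladderPoly_one_ne_zero (n : ℕ) {s : ℝ} (hs : 0 < s) : ladderPoly 1 n s ≠ 0 := by
  induction n generalizing s with
  | zero => simp [ladderPoly]
  | succ n ih =>
    intro h0
    have h1 := derivative_ladderPoly_succ 1 n s
    rw [h0, derivative_zero] at h1
    have h2 : (1 : ℝ) * (n + 1) * (n + 2 * s + 1) ≠ 0 := by positivity
    rcases mul_eq_zero.1 h1.symm with h | h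
    · exact h2 (C_eq_zero.1 h)
    · exact ih (by linarith) h

lemma eval_neg_ladderPoly (ε : ℝ) (n : ℕ) (s y : ℝ) :
    (ladderPoly ε n s).eval (-y) = (-1) ^ n * (ladderPoly ε n s).eval y ∧
      (derivative (ladderPoly ε n s)).eval (-y)
        = -(-1) ^ n * (derivative (ladderPoly ε n s)).eval y := by
  induction n generalizing s with
  | zero => simp [ladderPoly]
  | succ n ih =>
    obtain ⟨h1, h2⟩ := ih (s + 1)
    constructor
    · rw [eval_ladderPoly_succ, eval_ladderPoly_succ, h1, h2]
      ring
    · rw [derivative_ladderPoly_succ, eval_mul, eval_mul, eval_C, eval_C, h1]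
      ring

/-- The Gegenbauer polynomial of degree `n` has `n` zeros in `(-1, 1)`, by Rolle's theorem. -/
lemma exists_zeros_ladderPoly (n : ℕ) {s : ℝ} (hs : 0 < s) :
    ∃ z : ℕ → ℝ, z 0 = 1 ∧ z (n + 1) = -1 ∧ (∀ i ≤ n, z (i + 1) < z i) ∧
      ∀ i, 1 ≤ i → i ≤ n → (ladderPoly 1 n s).eval (z i) = 0 := by
  induction n generalizing s with
  | zero =>
    refine ⟨fun i => 1 - 2 * i, by simp, by norm_num, fun i hi => ?_, fun i h1 h2 => by omega⟩
    push_cast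
    linarith
  | succ n ih =>
    obtain ⟨z, hz0, hz1, hz, hzP⟩ := ih (s := s + 1) (by linarith)
    have hmono : ∀ i j, i ≤ j → j ≤ n + 1 → z j ≤ z i := by
      intro i j hij
      induction j, hij using Nat.le_induction with
      | base => exact fun _ => le_rfl
      | succ j _ ih => exact fun hj => (hz j (by omega)).le.trans (ih (by omega))
    set Q := ladderPoly 1 n (s + 1) with hQ
    -- The weight supplies the two additional zeros ±1, so Rolle yields n + 1 zeros from n.
    have hf0 : ∀ i ≤ n + 1, (1 - z i ^ 2) ^ (s + 1 / 2) * Q.eval (z i) = 0 := by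
      intro i hi
      rcases Nat.eq_zero_or_pos i with rfl | hi0
      · rw [hz0]
        simp [zero_rpow (by positivity : s + 2⁻¹ ≠ 0)]
      rcases eq_or_lt_of_le hi with rfl | hi1
      · rw [hz1]
        simp [zero_rpow (by positivity : s + 2⁻¹ ≠ 0)]
      · rw [hzP i hi0 (by omega), mul_zero]
    have hrolle : ∀ i, ∃ w, i ≤ n →
        (z (i + 1) < w ∧ w < z i) ∧ (ladderPoly 1 (n + 1) s).eval w = 0 := by
      intro i
      by_cases hi : i ≤ n
      swap
      · exact ⟨0, fun h => absurd h hi⟩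
      have hl : -1 ≤ z (i + 1) := by
        rw [← hz1]; exact hmono _ _ (by omega) le_rfl
      have hr : z i ≤ 1 := by
        rw [← hz0]; exact hmono _ _ (by omega) (by omega)
      have hpos : ∀ y ∈ Ioo (z (i + 1)) (z i), 0 < 1 - y ^ 2 := by
        intro y hy
        nlinarith [hy.1, hy.2]
      -- Up to sign and weight, the raising operator is differentiation of (1 - y²)^(s + 1/2) Q.
      obtain ⟨w, hw, hw0⟩ := exists_hasDerivAt_eq_zero (hz i hi)
        (f := fun y => (1 - y ^ 2) ^ (s + 1 / 2) * Q.eval y)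
        (f' := fun y => -((1 - y ^ 2) ^ (s - 1 / 2) * (ladderPoly 1 (n + 1) s).eval y))
        (by
          refine Continuous.continuousOn (Continuous.mul ?_ Q.continuous)
          exact (by fun_prop : Continuous fun y : ℝ => 1 - y ^ 2).rpow_const
            fun _ => Or.inr (by linarith))
        (by rw [hf0 i (by omega), hf0 (i + 1) (by omega)])
        (by
          intro y hy
          have hb : HasDerivAt (fun y : ℝ => 1 - y ^ 2) (-(2 * y)) y := by
            simpa using ((hasDerivAt_pow 2 y).const_sub 1)
          refine ((hb.rpow_const (p := s + 1 / 2) (Or.inl (hpos y hy).ne')).mul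
            (Q.hasDerivAt y)).congr_deriv ?_
          rw [eval_ladderPoly_succ, ← hQ]
          have e1 : (1 - y ^ 2) ^ (s + 1 / 2) = (1 - y ^ 2) ^ (s - 1 / 2) * (1 - y ^ 2) := by
            rw [← rpow_add_one (hpos y hy).ne']
            ring_nf
          rw [show s + 1 / 2 - 1 = s - 1 / 2 by ring, e1]
          ring)
      refine ⟨w, fun _ => ⟨hw, ?_⟩⟩
      exact (mul_eq_zero.1 (neg_eq_zero.1 hw0)).resolve_left
        (rpow_pos_of_pos (hpos w hw) (s - 1 / 2)).ne'
    choose w hw using hrolle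
    refine ⟨fun i => if i = 0 then 1 else if i = n + 2 then -1 else w (i - 1), by simp, by simp,
      fun i hi => ?_, fun i h1 h2 => ?_⟩
    · rcases Nat.eq_zero_or_pos i with rfl | hi0
      · have := (hw 0 (by omega)).1.2
        rw [hz0] at this
        simpa using this
      rcases eq_or_lt_of_le hi with rfl | hi1
      · have := (hw n le_rfl).1.1
        rw [hz1] at this
        simpa using this
      · obtain ⟨i, rfl⟩ := Nat.exists_eq_succ_of_ne_zero hi0.ne'
        have h1 := (hw i (by omega)).1.1
        have h2 := (hw (i + 1) (by omega)).1.2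
        simp only
        rw [if_neg (by omega), if_neg (by omega), if_neg (by omega), if_neg (by omega)]
        exact h2.trans h1
    · obtain ⟨i, rfl⟩ := Nat.exists_eq_succ_of_ne_zero (by omega : i ≠ 0)
      simp only
      rw [if_neg (by omega), if_neg (by omega)]
      exact (hw i (by omega)).2

/-! ### Upper bound on the Dirichlet levels. -/

/-- Comparison with the Pöschl–Teller potential `E cot² ≥ E cos²`. -/
lemma le_angularAngle_pi {h E s μ : ℝ} (hh : 0 < h) (hE : 0 ≤ E) (hs : 1 < s)
    (hsE : h ^ 2 * (s * (s - 1)) = E) (n : ℕ) (hμ : h ^ 2 * (s + n * (n + 2 * s)) < μ) :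
    (n + 1) * π ≤ angularAngle h E 0 μ π := by
  obtain ⟨z, hz0, hz1, hz, hzP⟩ := exists_zeros_ladderPoly n (s := s) (by linarith)
  have hmono : ∀ i j, i ≤ j → j ≤ n + 1 → z j ≤ z i := by
    intro i j hij
    induction j, hij using Nat.le_induction with
    | base => exact fun _ => le_rfl
    | succ j _ ih => exact fun hj => (hz j (by omega)).le.trans (ih (by omega))
  have hl : ∀ i ≤ n + 1, -1 ≤ z i := fun i hi => by rw [← hz1]; exact hmono _ _ hi le_rfl
  have hr : ∀ i ≤ n + 1, z i ≤ 1 := fun i hi => by rw [← hz0]; exact hmono _ _ (by omega) hi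
  set P := ladderPoly 1 n s with hP
  have hPd : ∀ x, HasDerivAt (fun x => P.eval (cos x)) ((derivative P).eval (cos x) * -sin x) x :=
    fun x => (P.hasDerivAt (cos x)).comp x (hasDerivAt_cos x)
  have hP'd : ∀ x, HasDerivAt (fun x => (derivative P).eval (cos x))
      ((derivative (derivative P)).eval (cos x) * -sin x) x :=
    fun x => ((derivative P).hasDerivAt (cos x)).comp x (hasDerivAt_cos x)
  -- The comparison function vanishes at 0, at the n points arccos (z i) and at π: n + 1 gaps. The z
  -- i decrease, so their arccosines increase.
  have key := (isPruferAngle_angularAngle h E 0 μ).mul_pi_le_of_zeros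
    (continuous_angularQ h E _) (n := n + 1) (z := fun i : ℕ => arccos (z i))
    (u := fun x => sin x ^ s * P.eval (cos x))
    (u' := fun x => cos x * s * sin x ^ (s - 1) * P.eval (cos x)
      + sin x ^ s * ((derivative P).eval (cos x) * -sin x))
    (q := fun x => s + n * (n + 2 * s) - s * (s - 1) * (cos x ^ 2 / sin x ^ 2))
    (by simp [hz0, angularAngle_zero]) (fun i hi => ?_) (fun i hi => ?_) (fun i hi => ?_)
    (fun x _ => (((hasDerivAt_sin x).rpow_const (Or.inr hs.le)).mul (hPd x))) ?_
    (fun x hx => ?_) (fun x hx => ?_)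
  · simpa [hz1] using key
  · exact strictAntiOn_arccos ⟨hl _ (by omega), hr _ (by omega)⟩
      ⟨hl _ (by omega), hr _ (by omega)⟩ (hz i (by omega))
  · rw [cos_arccos (hl i hi) (hr i hi)]
    rcases Nat.eq_zero_or_pos i with rfl | hi0
    · rw [hz0, arccos_one, sin_zero, zero_rpow (by linarith), zero_mul]
    rcases eq_or_lt_of_le hi with rfl | hi1
    · rw [hz1, arccos_neg_one, sin_pi, zero_rpow (by linarith), zero_mul]
    · rw [hzP i hi0 (by omega), mul_zero]
  · obtain ⟨y, hy, hy0⟩ : ∃ y ∈ Ioo (z (i + 1)) (z i), P.eval y ≠ 0 := by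
      by_contra! hcon
      refine ladderPoly_one_ne_zero n (by linarith : 0 < s)
        (eq_zero_of_infinite_isRoot _ ((Ioo_infinite (hz i (by omega))).mono fun y hy => hcon y hy))
    have h1 := hl (i + 1) (by omega)
    have h2 := hr i (by omega)
    have hy1 : -1 < y := h1.trans_lt hy.1
    have hy2 : y < 1 := hy.2.trans_le h2
    refine ⟨arccos y, ⟨strictAntiOn_arccos ⟨hy1.le, hy2.le⟩ ⟨hl _ (by omega), h2⟩ hy.2,
      strictAntiOn_arccos ⟨h1, hr _ (by omega)⟩ ⟨hy1.le, hy2.le⟩ hy.1⟩, ?_⟩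
    rw [cos_arccos hy1.le hy2.le]
    refine mul_ne_zero (rpow_pos_of_pos ?_ s).ne' hy0
    rw [sin_arccos]
    exact sqrt_pos.2 (by nlinarith)
  -- Since s > 1, u' is continuous up to 0 and π, where q may be singular.
  · have c1 : Continuous fun x => sin x ^ (s - 1) :=
      continuous_sin.rpow_const fun _ => Or.inr (by linarith)
    have c2 : Continuous fun x => sin x ^ s :=
      continuous_sin.rpow_const fun _ => Or.inr (by linarith)
    have c3 := P.continuous.comp continuous_cos
    have c4 := (derivative P).continuous.comp continuous_cos
    simp only [Function.comp_def] at c3 c4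
    fun_prop
  · simp only [hz0, hz1, arccos_one, arccos_neg_one] at hx
    have hsin : 0 < sin x := sin_pos_of_pos_of_lt_pi hx.1 hx.2
    have d1 : HasDerivAt (fun x => cos x * s * sin x ^ (s - 1) * P.eval (cos x)) _ x :=
      ((((hasDerivAt_cos x).mul_const s).mul
        ((hasDerivAt_sin x).rpow_const (p := s - 1) (Or.inl hsin.ne'))).mul (hPd x))
    have d2 : HasDerivAt (fun x => sin x ^ s * ((derivative P).eval (cos x) * -sin x)) _ x :=
      (((hasDerivAt_sin x).rpow_const (Or.inr hs.le)).mul ((hP'd x).mul (hasDerivAt_sin x).neg))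
    refine (d1.add d2).congr_deriv ?_
    have ode := eval_ladderPoly_ode 1 n s (cos x)
    rw [← hP] at ode
    have e2 : sin x ^ s = sin x ^ (s - 1 - 1) * sin x ^ 2 := by
      rw [← rpow_natCast, ← rpow_add hsin]
      congr 1
      push_cast
      ring
    have e1 : sin x ^ (s - 1) = sin x ^ (s - 1 - 1) * sin x := by
      rw [← rpow_add_one hsin.ne']
      ring_nf
    have e3 : cos x ^ 2 / sin x ^ 2 * sin x ^ 2 = cos x ^ 2 :=
      div_mul_cancel₀ _ (by positivity)
    simp only [Pi.mul_apply]
    rw [e2, e1]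
    generalize cos x ^ 2 / sin x ^ 2 = w at e3 ⊢
    generalize sin x ^ (s - 1 - 1) = T
    linear_combination (T * sin x ^ 2) * ode - (s * (s - 1) * P.eval (cos x) * T) * e3
      + (T * sin x ^ 2 * (derivative (derivative P)).eval (cos x)) * sin_sq_add_cos_sq x
  · rw [hz0, hz1, arccos_one, arccos_neg_one] at hx
    have hsin : 0 < sin x := sin_pos_of_pos_of_lt_pi hx.1 hx.2
    unfold angularQ
    rw [lt_div_iff₀ (by positivity)]
    have h1 : cos x ^ 2 ≤ cos x ^ 2 / sin x ^ 2 :=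
      le_div_self (sq_nonneg _) (by positivity) (sin_sq_le_one x)
    have h2 := mul_le_mul_of_nonneg_left h1 hE
    have h3 : (s + n * (n + 2 * s) - s * (s - 1) * (cos x ^ 2 / sin x ^ 2)) * h ^ 2
        = h ^ 2 * (s + n * (n + 2 * s)) - E * (cos x ^ 2 / sin x ^ 2) := by
      rw [← hsE]; ring
    rw [h3]
    linarith

/-! ### Lower bound on the Neumann levels. -/

/-- The derivative cos x - 1/cosh² x is positive because (1 - x²/2)(1 + x²) > 1 for 0 < x < 1. This
yields tanh² ≤ sin² near the well and, at 1, the strict gap that leaves room for the Gaussians. -/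
lemma strictMonoOn_sin_sub_sinh_div_cosh :
    StrictMonoOn (fun x => sin x - sinh x / cosh x) (Icc 0 1) := by
  have hd : ∀ x, HasDerivAt (fun x => sin x - sinh x / cosh x) (cos x - 1 / cosh x ^ 2) x := by
    intro x
    refine ((hasDerivAt_sin x).sub ((hasDerivAt_sinh x).div (hasDerivAt_cosh x)
      (cosh_pos x).ne')).congr_deriv ?_
    rw [← cosh_sq_sub_sinh_sq x]
    ring
  refine strictMonoOn_of_deriv_pos (convex_Icc 0 1)
    (fun x _ => (hd x).continuousAt.continuousWithinAt) fun x hx => ?_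
  rw [interior_Icc] at hx
  rw [(hd x).deriv, sub_pos, div_lt_iff₀ (by positivity)]
  have h1 := one_sub_sq_div_two_le_cos (x := x)
  have h2 : x ≤ sinh x := self_le_sinh_iff.2 hx.1.le
  have h3 : 1 + x ^ 2 ≤ cosh x ^ 2 := by
    rw [cosh_sq]
    nlinarith [hx.1]
  have hx2 : 0 < x ^ 2 := by nlinarith [hx.1]
  have hx1 : x ^ 2 < 1 := by nlinarith [hx.1, hx.2]
  have h4 : (1 - x ^ 2 / 2) * (1 + x ^ 2) ≤ cos x * cosh x ^ 2 :=
    mul_le_mul h1 h3 (by positivity) (by linarith)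
  nlinarith

lemma sinh_sq_div_cosh_sq_le_sin_sq {x : ℝ} (hx : x ∈ Icc (-1 : ℝ) 1) :
    sinh x ^ 2 / cosh x ^ 2 ≤ sin x ^ 2 := by
  have key : ∀ x ∈ Icc (0 : ℝ) 1, sinh x ^ 2 / cosh x ^ 2 ≤ sin x ^ 2 := by
    intro x hx
    have h1 := strictMonoOn_sin_sub_sinh_div_cosh.monotoneOn (left_mem_Icc.2 zero_le_one) hx hx.1
    simp only [sin_zero, sinh_zero, zero_div, sub_zero, sub_nonneg] at h1
    rw [← div_pow]
    exact pow_le_pow_left₀ (div_nonneg (sinh_nonneg_iff.2 hx.1) (cosh_pos x).le) h1 2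
  rcases le_total 0 x with h | h
  · exact key x ⟨h, hx.2⟩
  · simpa using key (-x) ⟨by linarith, by linarith [hx.1]⟩

lemma sinh_one_div_cosh_one_lt_sin_one : sinh 1 / cosh 1 < sin 1 := by
  have h1 := strictMonoOn_sin_sub_sinh_div_cosh (left_mem_Icc.2 zero_le_one)
    (right_mem_Icc.2 zero_le_one) one_pos
  simpa using h1

/-- At a fixed y the leading term of the raising step grows like s, so positivity survives for large
s. The bound B, independent of s, only carries the induction. At y = sinh 1 the signs show that the
logarithmic derivative of the bound state at 1 is at least -s tanh 1. -/
lemma exists_ladderPoly_neg_bound (n : ℕ) {y : ℝ} (hy : 0 < y) :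
    ∃ B S : ℝ, 0 ≤ B ∧ ∀ s ≥ S, 0 < (ladderPoly (-1) n (-s)).eval y ∧
      0 ≤ (derivative (ladderPoly (-1) n (-s))).eval y ∧
      (derivative (ladderPoly (-1) n (-s))).eval y ≤ B * (ladderPoly (-1) n (-s)).eval y := by
  induction n with
  | zero => exact ⟨0, 0, le_rfl, fun s _ => by simp [ladderPoly]⟩
  | succ n ih =>
    obtain ⟨B, S, hB, hS⟩ := ih
    refine ⟨2 * (n + 1) / y, max (S + 1) (max (n + 1) (1 + (1 + y ^ 2) * B / y)), by positivity,
      fun s hs => ?_⟩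
    have hs1 : S + 1 ≤ s := (le_max_left _ _).trans hs
    have hs2 : (n : ℝ) + 1 ≤ s := (le_max_left _ _).trans ((le_max_right _ _).trans hs)
    have hs3 : 1 + (1 + y ^ 2) * B / y ≤ s := (le_max_right _ _).trans ((le_max_right _ _).trans hs)
    obtain ⟨q0, q1, q2⟩ := hS (s - 1) (by linarith)
    rw [show -(s - 1) = -s + 1 by ring] at q0 q1 q2
    rw [derivative_ladderPoly_succ, eval_ladderPoly_succ, eval_mul, eval_C]
    set Q := (ladderPoly (-1) n (-s + 1)).eval y
    set Q' := (derivative (ladderPoly (-1) n (-s + 1))).eval y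
    have hn : (0 : ℝ) ≤ n := by positivity
    have hs0 : 0 < s := by linarith
    have h4 : y + (1 + y ^ 2) * B ≤ s * y := by
      have := mul_le_mul_of_nonneg_right hs3 hy.le
      rwa [add_mul, div_mul_cancel₀ _ hy.ne', one_mul] at this
    have h5 : (1 + y ^ 2) * Q' ≤ (1 + y ^ 2) * B * Q := by
      rw [mul_assoc]
      exact mul_le_mul_of_nonneg_left q2 (by positivity)
    have h6 : s * y * Q ≤ -1 * (2 * -s + 1) * y * Q - (1 - -1 * y ^ 2) * Q' := by
      nlinarith [mul_le_mul_of_nonneg_right h4 q0.le]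
    have h7 : 0 < s * y * Q := by positivity
    refine ⟨h7.trans_le h6, ?_, ?_⟩
    · refine mul_nonneg ?_ q0.le
      nlinarith
    · refine le_trans ?_ (mul_le_mul_of_nonneg_left h6 (by positivity))
      have : 2 * ((n : ℝ) + 1) / y * (s * y * Q) = (n + 1) * (2 * s) * Q := by field_simp
      rw [this]
      refine mul_le_mul_of_nonneg_right ?_ q0.le
      nlinarith

/-- The Prüfer angle of the Gaussian `exp (m (x - x₀)² / 2)`. -/
lemma isPruferAngle_gaussian (m x₀ : ℝ) :
    IsPruferAngle (fun x => -(m + (m * (x - x₀)) ^ 2))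
      (fun x => π / 2 - arctan (m * (x - x₀))) := by
  intro x
  have hl : HasDerivAt (fun x : ℝ => m * (x - x₀)) m x := by
    simpa using ((hasDerivAt_id x).sub_const x₀).const_mul m
  refine (hl.arctan.const_sub (π / 2)).congr_deriv ?_
  rw [cos_pi_div_two_sub, sin_pi_div_two_sub, cos_sq_arctan, sin_sq, cos_sq_arctan]
  field_simp
  ring

/-- The bound states of the modified Pöschl–Teller potential. -/
lemma hasDerivAt_cosh_rpow_mul_ladderPoly (n : ℕ) (s x : ℝ) :
    HasDerivAt (fun x => cosh x ^ (-s) * (ladderPoly (-1) n (-s)).eval (sinh x))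
      (cosh x ^ (-s) * (-s * (sinh x / cosh x) * (ladderPoly (-1) n (-s)).eval (sinh x)
        + cosh x * (derivative (ladderPoly (-1) n (-s))).eval (sinh x))) x ∧
    HasDerivAt (fun x => cosh x ^ (-s) * (-s * (sinh x / cosh x)
        * (ladderPoly (-1) n (-s)).eval (sinh x)
        + cosh x * (derivative (ladderPoly (-1) n (-s))).eval (sinh x)))
      (-(s + n * (2 * s - n) - s * (s + 1) * (sinh x ^ 2 / cosh x ^ 2))
        * (cosh x ^ (-s) * (ladderPoly (-1) n (-s)).eval (sinh x))) x := by
  have hc : cosh x ≠ 0 := (cosh_pos x).ne'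
  have ode := eval_ladderPoly_ode (-1) n (-s) (sinh x)
  set P := ladderPoly (-1) n (-s)
  have hP := (P.hasDerivAt (sinh x)).comp x (hasDerivAt_sinh x)
  have hP' := ((derivative P).hasDerivAt (sinh x)).comp x (hasDerivAt_sinh x)
  have hr : HasDerivAt (fun x => cosh x ^ (-s)) (cosh x ^ (-s) * (-s * (sinh x / cosh x))) x := by
    refine ((hasDerivAt_cosh x).rpow_const (p := -s) (Or.inl hc)).congr_deriv ?_
    rw [rpow_sub_one hc]
    ring
  have ht : HasDerivAt (fun x => sinh x / cosh x) (1 / cosh x ^ 2) x := by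
    refine ((hasDerivAt_sinh x).div (hasDerivAt_cosh x) hc).congr_deriv ?_
    rw [← cosh_sq_sub_sinh_sq x]
    ring
  constructor
  · refine (hr.mul hP).congr_deriv ?_
    simp only [Function.comp_apply]
    ring
  · have hin := ((ht.const_mul (-s)).mul hP).add ((hasDerivAt_cosh x).mul hP')
    refine (hr.mul hin).congr_deriv ?_
    simp only [Function.comp_apply, Pi.mul_apply, Pi.add_apply]
    have hsq := cosh_sq x
    generalize cosh x ^ (-s) = T
    have h1 : 1 - -1 * sinh x ^ 2 = cosh x ^ 2 := by rw [hsq]; ring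
    rw [h1] at ode
    have e1 : sinh x / cosh x * cosh x = sinh x := div_mul_cancel₀ _ hc
    have e2 : 1 / cosh x ^ 2 = 1 - (sinh x / cosh x) ^ 2 := by
      rw [div_pow]
      field_simp
      linarith
    rw [e2, ← div_pow]
    generalize sinh x / cosh x = t at e1 ⊢
    linear_combination T * ode - (2 * s * (derivative P).eval (sinh x) * T) * e1

/-- If `u` has at most `n` zeros then its Prüfer angle stays below `(n + 1) π`. -/
lemma IsPruferAngle.lt_of_card_zeros {Q φ u u' : ℝ → ℝ} (hφ : IsPruferAngle Q φ) {a b : ℝ}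
    (hab : a ≤ b) (hW : ∀ x ∈ Icc a b, u' x * sin (φ x) = u x * cos (φ x)) (ha : φ a < π)
    {n : ℕ} (hn : ∀ x : Fin (n + 1) → ℝ, Function.Injective x → ¬ ∀ i, u (x i) = 0) :
    φ b < (n + 1) * π := by
  by_contra! hge
  have hex : ∀ i : Fin (n + 1), ∃ x ∈ Icc a b, φ x = ((i : ℕ) + 1) * π := by
    intro i
    have hi : ((i : ℕ) : ℝ) ≤ n := by exact_mod_cast Nat.lt_succ_iff.1 i.2
    have hi0 : (0 : ℝ) ≤ (i : ℕ) := by positivity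
    exact intermediate_value_Icc hab hφ.continuous.continuousOn
      ⟨by nlinarith [pi_pos], by nlinarith [pi_pos]⟩
  choose x hx hφx using hex
  refine hn x (fun i j hij => ?_) fun i => ?_
  · have h2 := hφx i
    rw [hij, hφx j] at h2
    have h3 := mul_right_cancel₀ pi_ne_zero h2
    have h4 : ((j : ℕ) : ℝ) = (i : ℕ) := by linarith
    exact Fin.ext (by exact_mod_cast h4.symm)
  · have h1 := hW (x i) (hx i)
    rw [hφx i, show ((i : ℕ) + 1 : ℝ) * π = ((i + 1 : ℕ) : ℝ) * π by push_cast; ring,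
      sin_nat_mul_pi, mul_zero] at h1
    refine (mul_eq_zero.1 h1.symm).resolve_right fun h0 => ?_
    have := abs_cos_int_mul_pi ((i + 1 : ℕ) : ℤ)
    rw [Int.cast_natCast, h0] at this
    norm_num at this

/-- With φ = π/2 + nπ + δ, the relation says v' cos δ = -v sin δ. If δ exceeded arctan k, the bound
on φ would give δ < π/2, so v'/v = -tan δ < -k. -/
lemma le_add_arctan_of_neg_mul_le {v v' k φ : ℝ} (hv : 0 < v) (hv' : -k * v ≤ v')
    (hW : v' * sin φ = v * cos φ) {n : ℕ} (hφ : φ < (n + 1) * π) :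
    φ ≤ π / 2 + arctan k + n * π := by
  by_contra! hgt
  obtain ⟨δ, hδ⟩ : ∃ δ, δ = φ - n * π - π / 2 := ⟨_, rfl⟩
  have hδ1 : arctan k < δ := by linarith
  have hδ2 : δ < π / 2 := by linarith
  have hδ0 : -(π / 2) < δ := (neg_pi_div_two_lt_arctan k).trans hδ1
  have hcos := cos_pos_of_mem_Ioo ⟨hδ0, hδ2⟩
  have htan : k < tan δ := by
    rw [← arctan_tan hδ0 hδ2] at hδ1
    exact arctan_strictMono.lt_iff_lt.1 hδ1
  rw [show φ = δ + π / 2 + n * π by rw [hδ]; ring, sin_add_nat_mul_pi, cos_add_nat_mul_pi,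
    sin_add_pi_div_two, cos_add_pi_div_two] at hW
  have h2 : v' * cos δ = -(v * sin δ) := by
    have h3 : ((-1 : ℝ) ^ n) ≠ 0 := pow_ne_zero n (by norm_num)
    refine mul_left_cancel₀ h3 ?_
    linear_combination hW
  have h4 : k * cos δ < sin δ := by
    rwa [tan_eq_sin_div_cos, lt_div_iff₀ hcos] at htan
  nlinarith [mul_le_mul_of_nonneg_right hv' hcos.le, mul_lt_mul_of_pos_left h4 hv]

/-- Comparison with the potential `E tanh²` near the well, and with Gaussians away from it. -/
lemma angularAngle_pi_le {h E s : ℝ} (hh : 0 < h) (hE : 0 ≤ E) (hs : 0 < s)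
    (hsE : h ^ 2 * (s * (s + 1)) = E) (n : ℕ)
    (hP : 0 < (ladderPoly (-1) n (-s)).eval (sinh 1))
    (hP' : 0 ≤ (derivative (ladderPoly (-1) n (-s))).eval (sinh 1))
    (hgap : h ^ 2 * (s * (sinh 1 / cosh 1) / (π / 2 - 1) + (s * (sinh 1 / cosh 1)) ^ 2
      + (s + n * (2 * s - n))) ≤ E * sin 1 ^ 2) :
    angularAngle h E (π / 2) (h ^ 2 * (s + n * (2 * s - n))) π ≤ π / 2 + n * π := by
  set μ := h ^ 2 * (s + n * (2 * s - n)) with hμ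
  set k := s * (sinh 1 / cosh 1) with hk
  have hT : 0 < π / 2 - 1 := by linarith [pi_gt_three]
  have hc1 : 0 < cosh 1 := cosh_pos 1
  have hk0 : 0 < k := by
    have : 0 < sinh 1 := sinh_pos_iff.2 one_pos
    positivity
  have hh2 : 0 < h ^ 2 := by positivity
  -- A Gaussian centred at ±π/2 then has logarithmic derivative of absolute value k = s tanh 1 at
  -- ±1, matching the bound for the inner solution.
  set m := k / (π / 2 - 1) with hm
  have hmT : m * (π / 2 - 1) = k := div_mul_cancel₀ _ hT.ne'
  have hm0 : 0 < m := by positivity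
  set P := ladderPoly (-1) n (-s) with hPdef
  set u := fun x => cosh x ^ (-s) * P.eval (sinh x) with hu
  set u' := fun x => cosh x ^ (-s) * (-s * (sinh x / cosh x) * P.eval (sinh x)
    + cosh x * (derivative P).eval (sinh x)) with hu'
  set q := fun x => s + n * (2 * s - n) - s * (s + 1) * (sinh x ^ 2 / cosh x ^ 2) with hq
  have hqc : Continuous q := by
    have : ∀ x, cosh x ^ 2 ≠ 0 := fun x => (pow_pos (cosh_pos x) 2).ne'
    have h1 := continuous_sinh
    have h2 := continuous_cosh
    fun_prop (disch := exact this _)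
  have hqb : ∀ x, |q x| ≤ |s + n * (2 * s - n)| + s * (s + 1) := by
    intro x
    refine (abs_sub _ _).trans (add_le_add le_rfl ?_)
    rw [abs_of_nonneg (by positivity)]
    refine mul_le_of_le_one_right (by positivity) ?_
    rw [div_le_one (by have := cosh_pos x; positivity), cosh_sq]
    linarith
  have husol : IsSolution q u u' := fun x => hasDerivAt_cosh_rpow_mul_ladderPoly n s x
  have hu1 : 0 < u 1 := mul_pos (rpow_pos_of_pos hc1 _) hP
  have hu1' : -k * u 1 ≤ u' 1 := by
    have h1 : 0 ≤ cosh 1 ^ (-s) * (cosh 1 * (derivative P).eval (sinh 1)) := by positivity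
    have h2 : u' 1 = -k * u 1 + cosh 1 ^ (-s) * (cosh 1 * (derivative P).eval (sinh 1)) := by
      simp only [hu, hu', hk]
      ring
    linarith
  have hpar := eval_neg_ladderPoly (-1) n (-s) (sinh 1)
  rw [← hPdef] at hpar
  have hum : u (-1) = (-1) ^ n * u 1 := by
    simp only [hu, cosh_neg, sinh_neg, hpar.1]
    ring
  have hum' : u' (-1) = -(-1) ^ n * u' 1 := by
    simp only [hu', cosh_neg, sinh_neg, hpar.1, hpar.2]
    ring
  -- Translation by π/2 moves the well to 0 and turns cos² into sin².
  obtain ⟨θ, hθ, hθm, hθp⟩ : ∃ θ, IsPruferAngle (fun x => (μ - E * sin x ^ 2) / h ^ 2) θ ∧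
      θ (-(π / 2)) = π / 2 ∧ θ (π / 2) = angularAngle h E (π / 2) μ π := by
    refine ⟨fun x => angularAngle h E (π / 2) μ (x + π / 2), fun x => ?_, ?_, ?_⟩
    · refine ((isPruferAngle_angularAngle h E (π / 2) μ (x + π / 2)).comp_add_const x
        (π / 2)).congr_deriv ?_
      rw [angularQ, cos_add_pi_div_two, neg_sq]
    · simp [angularAngle_zero]
    · simp
  have hθQ : Continuous fun x => (μ - E * sin x ^ 2) / h ^ 2 := by fun_prop
  -- far from the well the potential exceeds that of the Gaussian
  have hfar : ∀ x c : ℝ, sin 1 ^ 2 ≤ sin x ^ 2 → c ^ 2 ≤ k ^ 2 →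
      (μ - E * sin x ^ 2) / h ^ 2 ≤ -(m + c ^ 2) := by
    intro x c hx hc
    rw [div_le_iff₀ hh2]
    have h1 := mul_le_mul_of_nonneg_left hx hE
    have h2 := mul_le_mul_of_nonneg_left hc hh2.le
    have h3 : h ^ 2 * (m + k ^ 2 + (s + n * (2 * s - n))) ≤ E * sin 1 ^ 2 := hgap
    linarith
  have hsin : ∀ x ∈ Icc 1 (π / 2), sin 1 ^ 2 ≤ sin x ^ 2 := by
    intro x hx
    refine pow_le_pow_left₀ (sin_nonneg_of_nonneg_of_le_pi zero_le_one (by linarith)) ?_ 2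
    exact sin_le_sin_of_le_of_le_pi_div_two (by linarith) hx.2 hx.1
  have hleft : θ (-1) ≤ π / 2 - arctan k := by
    have := hθ.le_of_le hθQ (isPruferAngle_gaussian m (-(π / 2))) (a := -(π / 2)) (b := -1)
      (fun x hx => ?_) (by linarith) (by simp [hθm])
    · rwa [show m * (-1 - -(π / 2)) = k by rw [← hmT]; ring] at this
    · refine hfar x _ ?_ ?_
      · have := hsin (-x) ⟨by linarith [hx.2], by linarith [hx.1]⟩
        rwa [sin_neg, neg_sq] at this
      · have h1 : 0 ≤ x - -(π / 2) := by linarith [hx.1]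
        refine pow_le_pow_left₀ (by positivity) ?_ 2
        rw [← hmT]
        exact mul_le_mul_of_nonneg_left (by linarith [hx.2]) hm0.le
  -- φ is the angle of u; by parity u'/u at -1 is -u'/u at 1, hence at most k, so φ starts above θ.
  obtain ⟨φ, hφm, hφ⟩ := exists_pruferAngle hqc hqb (-1) (π / 2 - arctan (u' (-1) / u (-1)))
  have hratio : u' (-1) / u (-1) = -(u' 1 / u 1) := by
    rw [hum, hum', neg_mul, neg_div, mul_div_mul_left _ _ (pow_ne_zero n (by norm_num))]
  have hφleft : θ (-1) ≤ φ (-1) := by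
    refine hleft.trans ?_
    rw [hφm]
    refine sub_le_sub_left (arctan_strictMono.monotone ?_) _
    rw [hratio, ← neg_div, div_le_iff₀ hu1]
    linarith
  have hmid : θ 1 ≤ φ 1 := by
    refine hθ.le_of_le hθQ hφ (fun x hx => ?_) (by norm_num) hφleft
    rw [div_le_iff₀ hh2]
    have h1 := mul_le_mul_of_nonneg_left (sinh_sq_div_cosh_sq_le_sin_sq hx) hE
    have h2 : q x * h ^ 2 = μ - E * (sinh x ^ 2 / cosh x ^ 2) := by
      simp only [hq, hμ]
      rw [← hsE]
      ring
    linarith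
  have hW : ∀ x ∈ Icc (-1 : ℝ) 1, u' x * sin (φ x) = u x * cos (φ x) := by
    intro x hx
    refine hφ.solution_mul_eq hqc (fun x _ => husol x) ?_ hx
    have hne : u (-1) ≠ 0 := by
      rw [hum]
      exact mul_ne_zero (pow_ne_zero n (by norm_num)) hu1.ne'
    rw [hφm, sin_pi_div_two_sub, cos_pi_div_two_sub]
    conv_rhs => rw [← tan_mul_cos (cos_arctan_pos (u' (-1) / u (-1))).ne', tan_arctan]
    field_simp
  -- u has at most n zeros, since its polynomial factor has degree at most n and sinh is injective.
  have hφlt : φ 1 < (n + 1) * π := by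
    refine hφ.lt_of_card_zeros (by norm_num) hW ?_ fun x hinj hx0 => ?_
    · rw [hφm]
      linarith [neg_pi_div_two_lt_arctan (u' (-1) / u (-1))]
    have hroot : ∀ i, P.eval (sinh (x i)) = 0 := fun i =>
      (mul_eq_zero.1 (hx0 i)).resolve_left (rpow_pos_of_pos (cosh_pos _) _).ne'
    have hdeg : P.natDegree < Fintype.card (Fin (n + 1)) := by
      rw [Fintype.card_fin]
      exact Nat.lt_succ_of_le (natDegree_ladderPoly_le _ _ _)
    have := eq_zero_of_natDegree_lt_card_of_eval_eq_zero P (sinh_injective.comp hinj) hroot hdeg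
    rw [this, eval_zero] at hP
    exact lt_irrefl _ hP
  have hφright : φ 1 ≤ π / 2 + arctan k + n * π :=
    le_add_arctan_of_neg_mul_le hu1 hu1' (hW 1 ⟨by norm_num, le_rfl⟩) hφlt
  rw [← hθp]
  have hβ := (isPruferAngle_gaussian m (π / 2)).add_int_mul_pi n
  have := hθ.le_of_le hθQ hβ (a := 1) (b := π / 2) (fun x hx => ?_) (by linarith) ?_
  · simpa using this
  · refine hfar x _ (hsin x hx) ?_
    rw [← neg_sq, ← mul_neg]
    refine pow_le_pow_left₀ (mul_nonneg hm0.le (by linarith [hx.2])) ?_ 2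
    rw [← hmT]
    exact mul_le_mul_of_nonneg_left (by linarith [hx.1]) hm0.le
  · refine hmid.trans (hφright.trans_eq ?_)
    rw [show m * (1 - π / 2) = -k by rw [← hmT]; ring, arctan_neg, Int.cast_natCast]
    ring

/-! ### Expansion of the bounds in h. -/

lemma muMinus_le {h E : ℝ} (hh : 0 < h) (hE : 0 < E) (n : ℕ) :
    muMinus n h E 0 ≤ (2 * n + 1) * √E * h + (n ^ 2 + 2 * n + 2) * h ^ 2 := by
  obtain ⟨a, ha0, ha⟩ : ∃ a : ℝ, 0 < a ∧ a ^ 2 = E / h ^ 2 :=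
    ⟨√E / h, by positivity, by rw [div_pow, sq_sqrt hE.le]⟩
  have hah : a * h = √E := by
    rw [eq_comm, sqrt_eq_iff_mul_self_eq hE.le (by positivity)]
    have : a ^ 2 * h ^ 2 = E := by rw [ha]; field_simp
    linarith
  -- The positive root of s(s - 1) = a², where a = √E/h.
  obtain ⟨s, hs⟩ : ∃ s, s = 1 / 2 + √(1 / 4 + a ^ 2) := ⟨_, rfl⟩
  have hsq := sq_sqrt (show 0 ≤ 1 / 4 + a ^ 2 by positivity)
  have hs1 : 1 < s := by
    have : 1 / 2 < √(1 / 4 + a ^ 2) := lt_sqrt_of_sq_lt (by nlinarith)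
    linarith
  have hsa : s ≤ a + 1 := by
    have : √(1 / 4 + a ^ 2) ≤ a + 1 / 2 := sqrt_le_iff.2 ⟨by linarith, by nlinarith⟩
    linarith
  have hsE : h ^ 2 * (s * (s - 1)) = E := by
    have : s * (s - 1) = E / h ^ 2 := by
      rw [← ha, hs]
      linarith
    rw [this]
    field_simp
  -- The additional h² supplies the strict inequality on μ and is absorbed in the error.
  have key := le_angularAngle_pi hh hE.le hs1 hsE n
    (μ := h ^ 2 * (s + n * (n + 2 * s)) + h ^ 2) (by have := pow_pos hh 2; linarith)
  have hle : muMinus n h E 0 ≤ h ^ 2 * (s + n * (n + 2 * s)) + h ^ 2 := by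
    rw [← (strictMono_angularAngle_pi hh E 0).le_iff_le]
    simp only [(muMinus_spec hh hE.le).2.2]
    linarith
  refine hle.trans ?_
  have h1 : h ^ 2 * ((2 * n + 1) * s) ≤ h ^ 2 * ((2 * n + 1) * (a + 1)) :=
    mul_le_mul_of_nonneg_left (mul_le_mul_of_nonneg_left hsa (by positivity)) (by positivity)
  have h2 : (2 * n + 1) * √E * h = h ^ 2 * ((2 * n + 1) * a) := by
    rw [← hah]; ring
  rw [h2]
  linarith

lemma eventually_le_muPlus {E : ℝ} (hE : 0 < E) (n : ℕ) :
    ∀ᶠ h in 𝓝[>] (0 : ℝ),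
      (2 * n + 1) * √E * h - (n ^ 2 + n + 1) * h ^ 2 ≤ muPlus n h E 0 := by
  have hsE0 : 0 < √E := sqrt_pos.2 hE
  have hsh : 0 < sinh 1 := sinh_pos_iff.2 one_pos
  obtain ⟨B, S, -, hS⟩ := exists_ladderPoly_neg_bound n hsh
  have hT : 0 < π / 2 - 1 := by linarith [pi_gt_three]
  obtain ⟨t, ht⟩ : ∃ t, t = sinh 1 / cosh 1 := ⟨_, rfl⟩
  have ht0 : 0 < t := by rw [ht]; exact div_pos hsh (cosh_pos 1)
  have htgap : t ^ 2 < sin 1 ^ 2 := by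
    rw [ht] at ht0 ⊢
    exact pow_lt_pow_left₀ sinh_one_div_cosh_one_lt_sin_one ht0.le two_ne_zero
  -- smallness of `h`
  have e1 : ∀ᶠ h in 𝓝[>] (0 : ℝ), h * (|S| + 1) < √E := by
    have hc : Continuous fun h : ℝ => h * (|S| + 1) := by fun_prop
    exact (hc.tendsto' 0 0 (by simp)).mono_left nhdsWithin_le_nhds
      |>.eventually (gt_mem_nhds hsE0)
  have e2 : ∀ᶠ h in 𝓝[>] (0 : ℝ), h * (√E * (t / (π / 2 - 1) + (2 * n + 1)))
      < E * (sin 1 ^ 2 - t ^ 2) := by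
    have hc : Continuous fun h : ℝ => h * (√E * (t / (π / 2 - 1) + (2 * n + 1))) := by fun_prop
    exact (hc.tendsto' 0 0 (by simp)).mono_left nhdsWithin_le_nhds
      |>.eventually (gt_mem_nhds (mul_pos hE (sub_pos.2 htgap)))
  filter_upwards [e1, e2, self_mem_nhdsWithin] with h h1 h2 hh
  replace hh : 0 < h := hh
  obtain ⟨a, ha0, ha⟩ : ∃ a : ℝ, 0 < a ∧ a ^ 2 = E / h ^ 2 :=
    ⟨√E / h, by positivity, by rw [div_pow, sq_sqrt hE.le]⟩
  have hah : h * a = √E := by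
    rw [eq_comm, sqrt_eq_iff_mul_self_eq hE.le (by positivity)]
    have : a ^ 2 * h ^ 2 = E := by rw [ha]; field_simp
    linarith
  have haS : |S| + 1 < a := by
    rw [← hah] at h1
    exact lt_of_mul_lt_mul_left h1 hh.le
  -- The positive root of s(s + 1) = a²; it lies between a - 1/2 and a.
  obtain ⟨s, hs⟩ : ∃ s, s = -(1 / 2) + √(1 / 4 + a ^ 2) := ⟨_, rfl⟩
  have hsq := sq_sqrt (show 0 ≤ 1 / 4 + a ^ 2 by positivity)
  have hsa1 : a - 1 / 2 ≤ s := by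
    have : a ≤ √(1 / 4 + a ^ 2) := le_sqrt_of_sq_le (by linarith)
    linarith
  have hsa2 : s ≤ a := by
    have : √(1 / 4 + a ^ 2) ≤ a + 1 / 2 := sqrt_le_iff.2 ⟨by linarith, by nlinarith⟩
    linarith
  have hs0 : 0 < s := by linarith [abs_nonneg S]
  have hsS : S ≤ s := by linarith [le_abs_self S]
  have hsE : h ^ 2 * (s * (s + 1)) = E := by
    have : s * (s + 1) = E / h ^ 2 := by
      rw [← ha, hs]
      linarith
    rw [this]
    field_simp
  have hlow : muPlus n h E 0 ≥ h ^ 2 * (s + n * (2 * s - n)) := by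
    rw [ge_iff_le, ← (strictMono_angularAngle_pi hh E (π / 2)).le_iff_le]
    simp only [(muPlus_spec hh hE.le).2.2]
    refine angularAngle_pi_le hh hE.le hs0 hsE n (hS s hsS).1 (hS s hsS).2.1 ?_
    rw [← ht]
    have g1 : s * t / (π / 2 - 1) ≤ a * (t / (π / 2 - 1)) := by
      rw [mul_div_assoc]
      exact mul_le_mul_of_nonneg_right hsa2 (by positivity)
    have g2 : (s * t) ^ 2 ≤ a ^ 2 * t ^ 2 := by
      rw [mul_pow]
      exact mul_le_mul_of_nonneg_right (pow_le_pow_left₀ hs0.le hsa2 2) (sq_nonneg t)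
    have g3 : s + n * (2 * s - n) ≤ (2 * n + 1) * a := by
      have : (2 * n + 1) * s ≤ (2 * n + 1) * a := mul_le_mul_of_nonneg_left hsa2 (by positivity)
      nlinarith [sq_nonneg (n : ℝ)]
    calc h ^ 2 * (s * t / (π / 2 - 1) + (s * t) ^ 2 + (s + n * (2 * s - n)))
        ≤ h ^ 2 * (a * (t / (π / 2 - 1)) + a ^ 2 * t ^ 2 + (2 * n + 1) * a) :=
          mul_le_mul_of_nonneg_left (by linarith) (by positivity)
      _ = h * (h * a * (t / (π / 2 - 1) + (2 * n + 1))) + h ^ 2 * a ^ 2 * t ^ 2 := by ring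
      _ = h * (√E * (t / (π / 2 - 1) + (2 * n + 1))) + E * t ^ 2 := by
          rw [hah, ha, mul_div_cancel₀ _ (by positivity)]
      _ ≤ E * sin 1 ^ 2 := by linarith
  refine le_trans ?_ hlow
  have h4 : (2 * n + 1) * √E * h = h ^ 2 * ((2 * n + 1) * a) := by
    rw [← hah]; ring
  have h5 : h ^ 2 * ((2 * n + 1) * (a - 1 / 2)) ≤ h ^ 2 * ((2 * n + 1) * s) :=
    mul_le_mul_of_nonneg_left (mul_le_mul_of_nonneg_left hsa1 (by positivity)) (by positivity)
  rw [h4]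
  nlinarith [sq_nonneg h]

lemma isBigO_sq_of_bounds {f g : ℝ → ℝ} {A B : ℝ} (hA : 0 ≤ A) (hB : 0 ≤ B)
    (h1 : ∀ᶠ h in 𝓝[>] (0 : ℝ), g h - A * h ^ 2 ≤ f h)
    (h2 : ∀ᶠ h in 𝓝[>] (0 : ℝ), f h ≤ g h + B * h ^ 2) :
    (fun h => f h - g h) =O[𝓝[>] (0 : ℝ)] fun h => h ^ 2 := by
  refine IsBigO.of_bound (A + B) ?_
  filter_upwards [h1, h2] with h l u
  rw [Real.norm_eq_abs, Real.norm_eq_abs, abs_of_nonneg (sq_nonneg h), abs_le]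
  constructor <;> nlinarith [mul_nonneg hA (sq_nonneg h), mul_nonneg hB (sq_nonneg h)]

end SturmLiouville

theorem corollary6p2 (E : ℝ) (hE : 0 < E) :
    (∀ h : ℝ, 0 < h → StrictMono (fun n : ℕ => TwoCenters.muPlus n h E 0) ∧
      Set.range (fun n : ℕ => TwoCenters.muPlus n h E 0) = TwoCenters.evenSpectrum h E 0) ∧
    (∀ h : ℝ, 0 < h → StrictMono (fun n : ℕ => TwoCenters.muMinus n h E 0) ∧
      Set.range (fun n : ℕ => TwoCenters.muMinus n h E 0) = TwoCenters.oddSpectrum h E 0) ∧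
    ∀ n : ℕ,
      ((fun h : ℝ => TwoCenters.muPlus n h E 0 - (2 * (n : ℝ) + 1) * Real.sqrt E * h)
        =O[𝓝[>] (0 : ℝ)] fun h : ℝ => h ^ 2) ∧
      ((fun h : ℝ => TwoCenters.muMinus n h E 0 - (2 * (n : ℝ) + 1) * Real.sqrt E * h)
        =O[𝓝[>] (0 : ℝ)] fun h : ℝ => h ^ 2) := by
  refine ⟨fun h hh => ?_, fun h hh => ?_, fun n => ?_⟩
  · have := SturmLiouville.muPlus_spec hh hE.le
    exact ⟨this.1, this.2.1⟩
  · have := SturmLiouville.muMinus_spec hh hE.le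
    exact ⟨this.1, this.2.1⟩
  have hlow := SturmLiouville.eventually_le_muPlus hE n
  have hup : ∀ᶠ h in 𝓝[>] (0 : ℝ), TwoCenters.muMinus n h E 0
      ≤ (2 * n + 1) * √E * h + (n ^ 2 + 2 * n + 2) * h ^ 2 := by
    filter_upwards [self_mem_nhdsWithin] with h hh
    exact SturmLiouville.muMinus_le hh hE n
  have hle : ∀ᶠ h in 𝓝[>] (0 : ℝ), TwoCenters.muPlus n h E 0 ≤ TwoCenters.muMinus n h E 0 := by
    filter_upwards [self_mem_nhdsWithin] with h hh
    exact SturmLiouville.muPlus_le_muMinus hh hE.le n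
  -- The ordering of the two families transfers each one-sided bound to the other family.
  have hup' := (hle.and hup).mono fun h hh => hh.1.trans hh.2
  have hlow' := (hlow.and hle).mono fun h hh => hh.1.trans hh.2
  exact ⟨SturmLiouville.isBigO_sq_of_bounds (by positivity) (by positivity) hlow hup',
    SturmLiouville.isBigO_sq_of_bounds (by positivity) (by positivity) hlow' hup⟩
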